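/- **Conventions.** For a strict $2$-category $\mathscr B$, the Duskin nerve $N_\Delta(\mathscr B)$ is the simplicial set whose $n$-simplices are the normal oplax functors $[n]\to\mathscr B$: objects $x_i$, $1$-cells $f_{ij}\colon x_i\to x_j$ for $i\le j$ with $f_{ii}=\mathrm{id}$, and $2$-cells $f_{ik}\Rightarrow f_{jk}f_{ij}$ for $i\le j\le k$, normalized and satisfying the evident coherence condition for $i\le j\le k\le l$. A *triple* $(X,X_\dagger,X^\dagger)$ consists of a quasi-category $X$ with two subcategories (of *ingressive* and *egressive* morphisms) that contain all equivalences; it is *adequate* if every cospan $C\xrightarrow{f}D\xleftarrow{i}B$ in $X$ with $f$ ingressive and $i$ egressive can be completed to an *ambigressive pullback*, i.e. a pullback square in $X$ in which the edges parallel to $f$ are ingressive and those parallel to $i$ are egressive. Barwick's effective Burnside category $A^{\mathrm{eff}}(X,X_\dagger,X^\dagger)$ is the simplicial set whose $n$-simplices are the functors $(i\le j)\mapsto X_{ij}$ to $X$ from the poset of pairs $0\le i\le j\le n$, with a morphism $X_{ij}\to X_{kl}$ for $i\le k\le l\le j$, such that for all $i\le k\le l\le j$ the square formed by $X_{ij}\to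 X_{kj}$ (ingressive), $X_{ij}\to X_{il}$ (egressive), $X_{kj}\to X_{kl}$ and $X_{il}\to X_{kl}$ is an ambigressive pullback. **Proposition.** Let $\mathscr I$ be a strict $(2,1)$-category and let $\mathscr I^\dagger\subset\mathscr I$ be a $2$-subcategory such that $(N_\Delta(\mathscr I),N_\Delta(\mathscr I),N_\Delta(\mathscr I^\dagger))$ is an adequate triple. Let $\mathscr C$ be a strict $2$-category and let $\mathscr C_{(2,1)}$ be the $(2,1)$-category obtained by discarding all non-invertible $2$-cells. Let $\phi\colon\mathscr I\to\mathscr C$ be a strict $2$-functor, write $f_!:=\phi(f)$ for $1$-cells $f$ and $\alpha_!:=\phi(\alpha)$ for $2$-cells $\alpha$, and assume: 1. for every $1$-cell $i$ of $\mathscr I^\dagger$ the $1$-cell $i_!$ has a right adjoint $i^*$; 2. for every pullback square in $N_\Delta(\mathscr I)$ with edges $g\colon A\to B$, $j\colon A\to C$, $i\colon B\to D$, $f\colon C\to D$ such that $i$ and $j$ belong to $\mathscr I^\dagger$, and with $\sigma\colon ig\Rightarrow fj$ the $2$-cell obtained by pasting the two invertible $2$-cells of the square along its diagonal, the canonical mate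 $\sigma_\lozenge\colon g_!j^*\Rightarrow i^*f_!$ of $\sigma_!$ (the composite $g_!j^*\Rightarrow i^*i_!g_!j^*\Rightarrow i^*f_!j_!j^*\Rightarrow i^*f_!$ of the unit of $i_!\dashv i^*$, of $\sigma_!$ and of the counit of $j_!\dashv j^*$) is an isomorphism. Then right adjoints $i_!\dashv i^*$ for all $1$-cells $i$ of $\mathscr I^\dagger$ can be chosen such that the adjunction chosen for every identity $1$-cell is the identity adjunction (so $(\mathrm{id})^*=\mathrm{id}$ with identity unit and counit). For every such choice there is a unique functor (i.e. map of simplicial sets) $$\Phi\colon A^{\mathrm{eff}}(N_\Delta(\mathscr I),N_\Delta(\mathscr I),N_\Delta(\mathscr I^\dagger))\to N_\Delta(\mathscr C_{(2,1)})$$ with the following property. Consider a $2$-simplex with objects $A=X_{00}$, $B=X_{01}$, $C=X_{02}$, $F=X_{11}$, $D=X_{12}$, $E=X_{22}$, with $1$-cells $j_{12}\colon B\to A$, $j_{01}\colon C\to B$, $j_{02}\colon C\to A$, $f\colon B\to F$, $i\colon D\to F$, $g_{01}\colon C\to D$, $g_{12}\colon D\to E$, $g_{02}\colon C\to E$, with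 $2$-cells $\rho\colon j_{02}\Rightarrow j_{12}j_{01}$ and $\tau\colon g_{02}\Rightarrow g_{12}g_{01}$, and with the $2$-cell $\sigma\colon ig_{01}\Rightarrow fj_{01}$ obtained by pasting the two $2$-cells filling the middle square. Then $\Phi$ sends it to the $2$-simplex with vertices $\phi(A),\phi(F),\phi(E)$, with edges $f_!j_{12}^*\colon\phi(A)\to\phi(F)$, $g_{12!}i^*\colon\phi(F)\to\phi(E)$ and $g_{02!}j_{02}^*\colon\phi(A)\to\phi(E)$, and with the (invertible) $2$-cell $$g_{02!}j_{02}^*\Rightarrow g_{12!}g_{01!}j_{01}^*j_{12}^*\Rightarrow g_{12!}i^*f_!j_{12}^*$$ obtained by pasting $(\rho^*)^{-1}$, $\tau_!$ and $\sigma_\lozenge$, where $\rho^*\colon j_{01}^*j_{12}^*\Rightarrow j_{02}^*$ is the total mate of $\rho_!$. -/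

import Mathlib

open CategoryTheory Bicategory Opposite

universe t w v u

/-! ### Nerves of preorders -/

section QuasiCategories

open Simplicial

/-- The nerve of a preorder `P`: its `m`-simplices are the monotone maps `[m] → P`. -/
def ordNerve (P : Type) [Preorder P] : SSet.{t} where
  obj m := ULift (Fin (m.unop.len + 1) →o P)
  map f := TypeCat.ofHom fun x => ⟨x.down.comp f.unop.toOrderHom⟩

namespace ordNerve

/-- The map of nerves induced by a monotone map. -/
def map {P Q : Type} [Preorder P] [Preorder Q] (f : P →o Q) :
    ordNerve.{t} P ⟶ ordNerve.{t} Q where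
  app _ := TypeCat.ofHom fun x => ⟨f.comp x.down⟩

/-- The vertex of the nerve given by an element. -/
def vertex {P : Type} [Preorder P] (p : P) : (ordNerve.{t} P) _⦋0⦌ :=
  ⟨OrderHom.const _ p⟩

/-- The edge of the nerve given by a relation `p ≤ q`. -/
def edge {P : Type} [Preorder P] {p q : P} (h : p ≤ q) : (ordNerve.{t} P) _⦋1⦌ :=
  ⟨⟨fun a => if a = (0 : Fin 2) then p else q, by
    intro a b hab
    change Fin 2 at a b
    change a ≤ b at hab
    fin_cases a <;> fin_cases b <;> simp_all⟩⟩

end ordNerve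

/-! ### Subcategories, pullbacks and adequate triples of `∞`-categories -/

/-- A simplicial subset `D` of a quasi-category `X` is a subcategory: it consists of all simplices
whose edges lie in a class of edges that is closed under composition. (A simplicial subset contains
the degenerate edge on each of its vertices, so that closure under homotopy is a special case of
closure under composition.) -/
structure IsInftySubcategory {X : SSet.{t}} (D : X.Subcomplex) : Prop where
  mem_of_edges : ∀ (n : ℕ) (x : X _⦋n⦌),
    (∀ e : ⦋1⦌ ⟶ ⦋n⦌, X.map e.op x ∈ D.obj (op ⦋1⦌)) → x ∈ D.obj (op ⦋n⦌)
  comp_mem : ∀ x : X _⦋2⦌, X.δ 2 x ∈ D.obj (op ⦋1⦌) → X.δ 0 x ∈ D.obj (op ⦋1⦌) →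
    X.δ 1 x ∈ D.obj (op ⦋1⦌)

/-- The simplicial subset `D` contains all equivalences of the quasi-category `X`. -/
def ContainsEquivalences {X : SSet.{t}} (D : X.Subcomplex) : Prop :=
  ∀ ⦃x y : X _⦋0⦌⦄ (e : SSet.Edge x y), Nonempty e.InvStruct → e.edge ∈ D.obj (op ⦋1⦌)

/-- A vertex `x` of a quasi-category is terminal: every map from the boundary of a simplex of
positive dimension that sends the last vertex to `x` extends to the simplex. -/
def IsTerminalVertex {X : SSet.{t}} (x : X _⦋0⦌) : Prop :=
  ∀ (n : ℕ) (b : (∂Δ[n + 1] : SSet.{t}) ⟶ X),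
    (∀ l : (∂Δ[n + 1] : SSet.{t}) _⦋0⦌,
      l.1 = SSet.stdSimplex.obj₀Equiv.symm (Fin.last (n + 1)) → b.app _ l = x) →
    ∃ f : Δ[n + 1] ⟶ X, (∂Δ[n + 1]).ι ≫ f = b

/-- The square, as a poset: the nerve of `SquareShape` is `Δ¹ × Δ¹`. The first coordinate is drawn
horizontally and the second one vertically. -/
abbrev SquareShape : Type := Fin 2 × Fin 2

/-- The cospan `(1,0) → (1,1) ← (0,1)` inside of the square. -/
abbrev CospanShape : Type := {p : SquareShape // p ≠ (0, 0)}

/-- The inclusion of the cospan into the square. -/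
def CospanShape.toSquare : CospanShape →o SquareShape := ⟨Subtype.val, fun _ _ h => h⟩

/-- The inclusion of a preorder `K` into the join `P ⋆ K`. -/
def joinInr (P K : Type) [Preorder P] [Preorder K] : K →o P ⊕ₗ K :=
  ⟨fun k => toLex (Sum.inr k), fun _ _ h => Sum.Lex.inr_le_inr_iff.2 h⟩

/-- The map `P ⋆ K → P' ⋆ K` of joins of preorders induced by a monotone map `P → P'`. -/
def joinMap {P P' : Type} (K : Type) [Preorder P] [Preorder P'] [Preorder K] (f : P →o P') :
    P ⊕ₗ K →o P' ⊕ₗ K where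
  toFun x := toLex (Sum.map f id (ofLex x))
  monotone' := by
    rintro (a | a) (b | b) h
    · exact Sum.Lex.inl_le_inl_iff.2 (f.monotone
        (Sum.Lex.inl_le_inl_iff.1 (show toLex (Sum.inl a) ≤ toLex (Sum.inl b) from h)))
    · exact Sum.Lex.inl_le_inr _ _
    · exact absurd h Sum.Lex.not_inr_le_inl
    · exact Sum.Lex.inr_le_inr_iff.2
        (Sum.Lex.inr_le_inr_iff.1 (show toLex (Sum.inr a) ≤ toLex (Sum.inr b) from h))

/-- The slice `X_{/p}` over a cospan `p` in `X`: an `m`-simplex is a map `Δᵐ ⋆ K → X` that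
restricts to `p` on the cospan `K`. -/
def cospanSlice {X : SSet.{t}} (p : ordNerve.{t} CospanShape ⟶ X) : SSet.{t} where
  obj m := {f : ordNerve.{t} (Fin (m.unop.len + 1) ⊕ₗ CospanShape) ⟶ X //
    ordNerve.map (joinInr _ _) ≫ f = p}
  map g := TypeCat.ofHom fun f =>
    ⟨ordNerve.map (joinMap CospanShape g.unop.toOrderHom) ≫ f.1, f.2⟩
  map_id m := by
    ext f k x
    refine congrArg (f.1.app k) (ULift.ext _ _ (OrderHom.ext _ _ (funext fun a => ?_)))
    change toLex (Sum.map id id (ofLex (x.down a))) = x.down a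
    simp
  map_comp g h := by
    ext f k x
    refine congrArg (f.1.app k) (ULift.ext _ _ (OrderHom.ext _ _ (funext fun a => ?_)))
    change toLex (Sum.map _ id (ofLex (x.down a))) =
      toLex (Sum.map _ id (Sum.map _ id (ofLex (x.down a))))
    rw [Sum.map_map]
    rfl

/-- The identification of `Δ⁰ ⋆ K` with the square, for `K` the cospan. -/
def coneToSquare : Fin 1 ⊕ₗ CospanShape →o SquareShape where
  toFun x := Sum.elim (fun _ => (0, 0)) Subtype.val (ofLex x)
  monotone' := by
    rintro (a | a) (b | b) h
    · exact le_rfl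
    · exact ⟨Fin.zero_le _, Fin.zero_le _⟩
    · exact absurd h Sum.Lex.not_inr_le_inl
    · have h' : a ≤ b :=
        Sum.Lex.inr_le_inr_iff.1 (show toLex (Sum.inr a) ≤ toLex (Sum.inr b) from h)
      exact h'

/-- A square in a quasi-category is a pullback if it is a limit cone over the cospan that it
contains, that is, a terminal object of the slice over that cospan. -/
def IsPullbackSquare {X : SSet.{t}} (q : ordNerve.{t} SquareShape ⟶ X) : Prop :=
  IsTerminalVertex
    (X := cospanSlice (ordNerve.map CospanShape.toSquare ≫ q))
    ⟨ordNerve.map coneToSquare ≫ q, rfl⟩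

/-- An ambigressive pullback: a pullback square whose horizontal edges are ingressive and whose
vertical edges are egressive. -/
structure IsAmbigressivePullback {X : SSet.{t}} (In Eg : X.Subcomplex)
    (q : ordNerve.{t} SquareShape ⟶ X) : Prop where
  isPullback : IsPullbackSquare q
  ingressive : ∀ a : Fin 2,
    q.app _ (ordNerve.edge (p := ((0, a) : SquareShape)) (q := (1, a))
      ⟨Fin.zero_le _, le_rfl⟩) ∈ In.obj (op ⦋1⦌)
  egressive : ∀ a : Fin 2,
    q.app _ (ordNerve.edge (p := ((a, 0) : SquareShape)) (q := (a, 1))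
      ⟨le_rfl, Fin.zero_le _⟩) ∈ Eg.obj (op ⦋1⦌)

/-- Barwick's adequate triples `(X, In, Eg)`: the ingressive and the egressive morphisms form
subcategories of `X` that contain all equivalences, and every cospan that consists of an ingressive
morphism `f` and an egressive morphism `i` can be completed to an ambigressive pullback. -/
structure IsAdequateTriple (X : SSet.{t}) (In Eg : X.Subcomplex) : Prop where
  ingressive_sub : IsInftySubcategory In
  egressive_sub : IsInftySubcategory Eg
  ingressive_equiv : ContainsEquivalences In
  egressive_equiv : ContainsEquivalences Eg
  exists_pullback : ∀ f i : X _⦋1⦌, f ∈ In.obj (op ⦋1⦌) → i ∈ Eg.obj (op ⦋1⦌) →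
    X.δ 0 f = X.δ 0 i →
    ∃ q : ordNerve.{t} SquareShape ⟶ X, IsAmbigressivePullback In Eg q ∧
      q.app _ (ordNerve.edge (p := ((0, 1) : SquareShape)) (q := (1, 1))
        ⟨Fin.zero_le _, le_rfl⟩) = f ∧
      q.app _ (ordNerve.edge (p := ((1, 0) : SquareShape)) (q := (1, 1))
        ⟨le_rfl, Fin.zero_le _⟩) = i

/-! ### The effective Burnside category -/

/-- The opposite of the twisted arrow category of `[n]`. Its objects are the pairs `i ≤ j` in `[n]`,
and there is a morphism from `i ≤ j` to `k ≤ l` if and only if `i ≤ k ≤ l ≤ j`. -/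
abbrev TwOp (n : ℕ) : Type := (NonemptyInterval (Fin (n + 1)))ᵒᵈ

/-- The object `i ≤ j` of the opposite of the twisted arrow category of `[n]`. -/
def tw {n : ℕ} (i j : Fin (n + 1)) (h : i ≤ j := by decide) : TwOp n :=
  OrderDual.toDual ⟨(i, j), h⟩

theorem tw_le {n : ℕ} {i j k l : Fin (n + 1)} (hij : i ≤ j) (hkl : k ≤ l) (hik : i ≤ k)
    (hlj : l ≤ j) : tw i j hij ≤ tw k l hkl :=
  ⟨hik, hlj⟩

/-- The functoriality of `TwOp` in monotone maps. -/
def TwOp.map {m n : ℕ} (f : Fin (m + 1) →o Fin (n + 1)) : TwOp m →o TwOp n where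
  toFun x := OrderDual.toDual ((OrderDual.ofDual x).map f)
  monotone' _ _ h := ⟨f.monotone h.1, f.monotone h.2⟩

/-- For `i ≤ k ≤ l ≤ j`, the square with corners `(i ≤ j)`, `(k ≤ j)`, `(i ≤ l)`, `(k ≤ l)` at
`(0,0)`, `(1,0)`, `(0,1)`, `(1,1)`, respectively. -/
def TwOp.square {n : ℕ} {i k l j : Fin (n + 1)} (hik : i ≤ k) (hkl : k ≤ l) (hlj : l ≤ j) :
    SquareShape →o TwOp n where
  toFun p := tw (if p.1 = 0 then i else k) (if p.2 = 0 then j else l) (by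
    split_ifs <;> order)
  monotone' := by
    rintro ⟨a, b⟩ ⟨c, d⟩ ⟨h, h'⟩
    apply tw_le <;> fin_cases a <;> fin_cases b <;> fin_cases c <;> fin_cases d <;> simp_all

/-- A diagram `TwOp n → X` is cartesian if for all `i ≤ k ≤ l ≤ j` the corresponding square
is an ambigressive pullback. -/
def IsCartesianDiagram {X : SSet.{t}} (In Eg : X.Subcomplex) {n : ℕ}
    (s : ordNerve.{t} (TwOp n) ⟶ X) : Prop :=
  ∀ ⦃i k l j : Fin (n + 1)⦄ (hik : i ≤ k) (hkl : k ≤ l) (hlj : l ≤ j),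
    IsAmbigressivePullback In Eg (ordNerve.map (TwOp.square hik hkl hlj) ≫ s)

theorem IsCartesianDiagram.comp_map {X : SSet.{t}} {In Eg : X.Subcomplex} {m n : ℕ}
    {s : ordNerve.{t} (TwOp n) ⟶ X} (hs : IsCartesianDiagram In Eg s)
    (f : Fin (m + 1) →o Fin (n + 1)) :
    IsCartesianDiagram In Eg (ordNerve.map (TwOp.map f) ≫ s) := by
  intro i k l j hik hkl hlj
  have h := hs (f.monotone hik) (f.monotone hkl) (f.monotone hlj)
  have e : (TwOp.map f).comp (TwOp.square hik hkl hlj) =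
      TwOp.square (f.monotone hik) (f.monotone hkl) (f.monotone hlj) := by
    apply OrderHom.ext
    funext ⟨a, b⟩
    fin_cases a <;> fin_cases b <;> rfl
  rw [← e] at h
  exact h

/-- Barwick's effective Burnside category `A^eff(X, In, Eg)`: the `n`-simplices are the cartesian
diagrams `TwOp n → X`. A morphism is thus a span with egressive backward leg and ingressive
forward leg. -/
def effBurnside (X : SSet.{t}) (In Eg : X.Subcomplex) : SSet.{t} where
  obj m := {s : ordNerve.{t} (TwOp m.unop.len) ⟶ X // IsCartesianDiagram In Eg s}
  map f := TypeCat.ofHom fun s =>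
    ⟨ordNerve.map (TwOp.map f.unop.toOrderHom) ≫ s.1, s.2.comp_map _⟩

end QuasiCategories

/-! ### The Duskin nerve -/

/-- A normal (strictly unital) oplax functor from a preorder `P` to a bicategory `B`. If all
`2`-cells of `B` are invertible, these are the normal pseudofunctors `P → B`. -/
@[ext]
structure NormalDiagram (P : Type) [Preorder P] (B : Type u) [Bicategory.{w, v} B] where
  /-- the objects -/
  obj : P → B
  /-- the `1`-cells -/
  map : ∀ {i j : P}, i ≤ j → (obj i ⟶ obj j)
  map_refl : ∀ i : P, map (le_refl i) = 𝟙 (obj i)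
  /-- the `2`-cells `f_{ik} ⟹ f_{jk} ∘ f_{ij}` -/
  comp : ∀ {i j k : P} (hij : i ≤ j) (hjk : j ≤ k), map (hij.trans hjk) ⟶ map hij ≫ map hjk
  comp_refl_left : ∀ {i j : P} (hij : i ≤ j),
    comp (le_refl i) hij ≫ eqToHom (map_refl i) ▷ map hij ≫ (λ_ (map hij)).hom = 𝟙 (map hij)
  comp_refl_right : ∀ {i j : P} (hij : i ≤ j),
    comp hij (le_refl j) ≫ map hij ◁ eqToHom (map_refl j) ≫ (ρ_ (map hij)).hom = 𝟙 (map hij)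
  comp_assoc : ∀ {i j k l : P} (hij : i ≤ j) (hjk : j ≤ k) (hkl : k ≤ l),
    comp (hij.trans hjk) hkl ≫ comp hij hjk ▷ map hkl ≫ (α_ _ _ _).hom =
      comp hij (hjk.trans hkl) ≫ map hij ◁ comp hjk hkl

namespace NormalDiagram

variable {P Q : Type} [Preorder P] [Preorder Q] {B : Type u} [Bicategory.{w, v} B]

/-- Restriction of diagrams along a monotone map. -/
def restrict (Y : NormalDiagram Q B) (f : P →o Q) : NormalDiagram P B where
  obj i := Y.obj (f i)
  map h := Y.map (f.monotone h)
  map_refl i := Y.map_refl (f i)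
  comp h h' := Y.comp (f.monotone h) (f.monotone h')
  comp_refl_left h := Y.comp_refl_left (f.monotone h)
  comp_refl_right h := Y.comp_refl_right (f.monotone h)
  comp_assoc h h' h'' := Y.comp_assoc (f.monotone h) (f.monotone h') (f.monotone h'')

end NormalDiagram

/-- The Duskin nerve of a bicategory, with `2`-cells oriented as `f_{02} ⟹ f_{12} ∘ f_{01}`. -/
def duskinNerve (B : Type u) [Bicategory.{w, v} B] : SSet.{max u v w} where
  obj m := NormalDiagram (Fin (m.unop.len + 1)) B
  map f := TypeCat.ofHom fun x => x.restrict f.unop.toOrderHom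

/-- The functor `N(P) → N_Δ(B)` given by a normal diagram `P → B`. (Since the Duskin nerve is
`3`-coskeletal, every such functor comes from a unique normal diagram.) -/
def NormalDiagram.toNerve {P : Type} [Preorder P] {B : Type u} [Bicategory.{w, v} B]
    (Y : NormalDiagram P B) : ordNerve.{max u v w} P ⟶ duskinNerve B where
  app _ := TypeCat.ofHom fun x => Y.restrict x.down

section Triangle

variable {B : Type u} [Bicategory.{w, v} B] {a b c : B}

/-- The objects of `triangle`. -/
def triangleObj (a b c : B) : Fin 3 → B
  | 0 => a
  | 1 => b
  | 2 => c

/-- The `1`-cells of `triangle`. -/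
def triangleMap (f : a ⟶ b) (g : b ⟶ c) (h : a ⟶ c) :
    ∀ i j : Fin 3, i ≤ j → (triangleObj a b c i ⟶ triangleObj a b c j)
  | 0, 0, _ => 𝟙 a
  | 0, 1, _ => f
  | 0, 2, _ => h
  | 1, 1, _ => 𝟙 b
  | 1, 2, _ => g
  | 2, 2, _ => 𝟙 c
  | 1, 0, p => absurd p (by decide)
  | 2, 0, p => absurd p (by decide)
  | 2, 1, p => absurd p (by decide)

/-- The `2`-cells of `triangle`. -/
def triangleComp {f : a ⟶ b} {g : b ⟶ c} {h : a ⟶ c} (θ : h ⟶ f ≫ g) :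
    ∀ (i j k : Fin 3) (p : i ≤ j) (q : j ≤ k), triangleMap f g h i k (p.trans q) ⟶
      triangleMap f g h i j p ≫ triangleMap f g h j k q
  | 0, 0, 0, _, _ => (λ_ (𝟙 a)).inv
  | 0, 0, 1, _, _ => (λ_ f).inv
  | 0, 0, 2, _, _ => (λ_ h).inv
  | 0, 1, 1, _, _ => (ρ_ f).inv
  | 0, 1, 2, _, _ => θ
  | 0, 2, 2, _, _ => (ρ_ h).inv
  | 1, 1, 1, _, _ => (λ_ (𝟙 b)).inv
  | 1, 1, 2, _, _ => (λ_ g).inv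
  | 1, 2, 2, _, _ => (ρ_ g).inv
  | 2, 2, 2, _, _ => (λ_ (𝟙 c)).inv
  | 1, 0, _, p, _ => absurd p (by decide)
  | 2, 0, _, p, _ => absurd p (by decide)
  | 2, 1, _, p, _ => absurd p (by decide)
  | 0, 1, 0, _, q => absurd q (by decide)
  | 0, 2, 0, _, q => absurd q (by decide)
  | 0, 2, 1, _, q => absurd q (by decide)
  | 1, 1, 0, _, q => absurd q (by decide)
  | 1, 2, 0, _, q => absurd q (by decide)
  | 1, 2, 1, _, q => absurd q (by decide)
  | 2, 2, 0, _, q => absurd q (by decide)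
  | 2, 2, 1, _, q => absurd q (by decide)

/-- The `2`-simplex of the Duskin nerve with edges `f = f_{01}`, `g = f_{12}`, `h = f_{02}` and
`2`-cell `θ`. -/
def triangle {f : a ⟶ b} {g : b ⟶ c} {h : a ⟶ c} (θ : h ⟶ f ≫ g) :
    NormalDiagram (Fin 3) B where
  obj := triangleObj a b c
  map {i j} p := triangleMap f g h i j p
  map_refl i := by fin_cases i <;> rfl
  comp {i j k} p q := triangleComp θ i j k p q
  comp_refl_left {i j} p := by
    have key : ∀ {x y : B} (m : x ⟶ y),
        (λ_ m).inv ≫ eqToHom rfl ▷ m ≫ (λ_ m).hom = 𝟙 m := by simp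
    fin_cases i <;> fin_cases j <;> first | exact absurd p (by decide) | exact key _
  comp_refl_right {i j} p := by
    have key : ∀ {x y : B} (m : x ⟶ y),
        (ρ_ m).inv ≫ m ◁ eqToHom rfl ≫ (ρ_ m).hom = 𝟙 m := by simp
    have key' : ∀ x : B,
        (λ_ (𝟙 x)).inv ≫ 𝟙 x ◁ eqToHom rfl ≫ (ρ_ (𝟙 x)).hom = 𝟙 (𝟙 x) := by
      simp
    fin_cases i <;> fin_cases j <;>
      first | exact absurd p (by decide) | exact key _ | exact key' _
  comp_assoc {i j k l} p q r := by
    have key₁ : ∀ {x y z : B} {m : x ⟶ y} {n : y ⟶ z} {o : x ⟶ z} (κ : o ⟶ m ≫ n),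
        κ ≫ (λ_ m).inv ▷ n ≫ (α_ _ _ _).hom = (λ_ o).inv ≫ 𝟙 x ◁ κ := by simp
    have key₂ : ∀ {x y z : B} {m : x ⟶ y} {n : y ⟶ z} {o : x ⟶ z} (κ : o ⟶ m ≫ n),
        κ ≫ (ρ_ m).inv ▷ n ≫ (α_ _ _ _).hom = κ ≫ m ◁ (λ_ n).inv := by simp
    have key₃ : ∀ {x y z : B} {m : x ⟶ y} {n : y ⟶ z} {o : x ⟶ z} (κ : o ⟶ m ≫ n),
        (ρ_ o).inv ≫ κ ▷ 𝟙 z ≫ (α_ _ _ _).hom = κ ≫ m ◁ (ρ_ n).inv := by simp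
    fin_cases i <;> fin_cases j <;> first | exact absurd p (by decide) | skip
    all_goals fin_cases k <;> first | exact absurd q (by decide) | skip
    all_goals fin_cases l <;>
      first | exact absurd r (by decide) | exact key₁ _ | exact key₂ _ | exact key₃ _

/-- The `2`-simplex `triangle θ` of the Duskin nerve of the underlying `(2,1)`-category `Pith B`, for
an invertible `2`-cell `θ` of `B`. -/
noncomputable def pithTriangle {f : a ⟶ b} {g : b ⟶ c} {h : a ⟶ c} (θ : h ⟶ f ≫ g) [IsIso θ] :
    NormalDiagram (Fin 3) (Pith B) :=
  triangle (B := Pith B) (a := ⟨a⟩) (b := ⟨b⟩) (c := ⟨c⟩) (f := ⟨f⟩) (g := ⟨g⟩) (h := ⟨h⟩)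
    (CoreHom.mk (asIso θ))

end Triangle

/-! ### Sub-`2`-categories -/

/-- A `2`-subcategory of a strict `2`-category: a class of objects, of `1`-cells and of `2`-cells,
closed under sources, targets, identities, and all compositions. -/
structure TwoSubcategory (B : Type u) [Bicategory.{w, v} B] where
  /-- the objects -/
  obj : B → Prop
  /-- the `1`-cells -/
  hom : ∀ {a b : B}, (a ⟶ b) → Prop
  /-- the `2`-cells -/
  hom₂ : ∀ {a b : B} {f g : a ⟶ b}, (f ⟶ g) → Prop
  src_mem : ∀ {a b : B} (f : a ⟶ b), hom f → obj a
  tgt_mem : ∀ {a b : B} (f : a ⟶ b), hom f → obj b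
  id_mem : ∀ a : B, obj a → hom (𝟙 a)
  comp_mem : ∀ {a b c : B} (f : a ⟶ b) (g : b ⟶ c), hom f → hom g → hom (f ≫ g)
  src₂_mem : ∀ {a b : B} {f g : a ⟶ b} (η : f ⟶ g), hom₂ η → hom f
  tgt₂_mem : ∀ {a b : B} {f g : a ⟶ b} (η : f ⟶ g), hom₂ η → hom g
  id₂_mem : ∀ {a b : B} (f : a ⟶ b), hom f → hom₂ (𝟙 f)
  comp₂_mem : ∀ {a b : B} {f g h : a ⟶ b} (η : f ⟶ g) (θ : g ⟶ h),
    hom₂ η → hom₂ θ → hom₂ (η ≫ θ)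
  whiskerLeft_mem : ∀ {a b c : B} (f : a ⟶ b) {g h : b ⟶ c} (η : g ⟶ h),
    hom f → hom₂ η → hom₂ (f ◁ η)
  whiskerRight_mem : ∀ {a b c : B} {f g : a ⟶ b} (η : f ⟶ g) (h : b ⟶ c),
    hom₂ η → hom h → hom₂ (η ▷ h)

/-- The Duskin nerve of a `2`-subcategory, as a simplicial subset of the ambient Duskin nerve. -/
def TwoSubcategory.nerve {B : Type u} [Bicategory.{w, v} B] (D : TwoSubcategory B) :
    (duskinNerve B).Subcomplex where
  obj m := {x : NormalDiagram (Fin (m.unop.len + 1)) B | (∀ i, D.obj (x.obj i)) ∧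
    (∀ {i j : Fin (m.unop.len + 1)} (h : i ≤ j), D.hom (x.map h)) ∧
    ∀ {i j k : Fin (m.unop.len + 1)} (h : i ≤ j) (h' : j ≤ k), D.hom₂ (x.comp h h')}
  map f _ hx := ⟨fun i => hx.1 (f.unop.toOrderHom i),
    fun h => hx.2.1 (f.unop.toOrderHom.monotone h),
    fun h h' => hx.2.2 (f.unop.toOrderHom.monotone h) (f.unop.toOrderHom.monotone h')⟩

/-- In a cartesian diagram in a Duskin nerve whose egressive morphisms are those of a
`2`-subcategory, the `1`-cells `(i ≤ j) → (i ≤ l)` belong to this `2`-subcategory. -/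
theorem IsCartesianDiagram.hom_mem {B : Type u} [Bicategory.{w, v} B] {D : TwoSubcategory B}
    {In : (duskinNerve B).Subcomplex} {n : ℕ} {Y : NormalDiagram (TwOp n) B}
    (hY : IsCartesianDiagram In D.nerve Y.toNerve) {i l j : Fin (n + 1)} (hil : i ≤ l)
    (hlj : l ≤ j) :
    D.hom (Y.map (tw_le (hil.trans hlj) hil le_rfl hlj)) :=
  ((hY (le_refl i) hil hlj).egressive 0).2.1 (i := (0 : Fin 2)) (j := (1 : Fin 2)) (by decide)

/-! ### Mates and the unfurling construction -/

section Mates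

variable {I C : Type u} [Bicategory.{w, v} I] [Bicategory.{w, v} C] (φ : StrictPseudofunctor I C)

/-- The canonical mate `σ_◊ : g_! j^* ⟹ i^* f_!` of `φ(σ)`, for a `2`-cell `σ : i g ⟹ f j` filling
a square in which `i_! = φ(i)` and `j_! = φ(j)` have right adjoints `i^*` and `j^*`. -/
def canonicalMate {a b c d : I} {g : a ⟶ b} {i : b ⟶ d} {j : a ⟶ c} {f : c ⟶ d}
    {rj : φ.obj c ⟶ φ.obj a} {ri : φ.obj d ⟶ φ.obj b} (adj_j : φ.map j ⊣ rj)
    (adj_i : φ.map i ⊣ ri) (σ : g ≫ i ⟶ j ≫ f) : rj ≫ φ.map g ⟶ φ.map f ≫ ri :=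
  mateEquiv adj_j adj_i ((φ.mapComp g i).inv ≫ φ.map₂ σ ≫ (φ.mapComp j f).hom)

/-- The total mate `ρ^* : j₀₁^* j₁₂^* ⟹ j₀₂^*` of `φ(ρ)`, for a `2`-cell `ρ : j₀₂ ⟹ j₁₂ j₀₁`. -/
def totalMate {a b c : I} {j₀₁ : c ⟶ b} {j₁₂ : b ⟶ a} {j₀₂ : c ⟶ a}
    {r₀₁ : φ.obj b ⟶ φ.obj c} {r₁₂ : φ.obj a ⟶ φ.obj b} {r₀₂ : φ.obj a ⟶ φ.obj c}
    (adj₀₁ : φ.map j₀₁ ⊣ r₀₁) (adj₁₂ : φ.map j₁₂ ⊣ r₁₂) (adj₀₂ : φ.map j₀₂ ⊣ r₀₂)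
    (ρ : j₀₂ ⟶ j₀₁ ≫ j₁₂) : r₁₂ ≫ r₀₁ ⟶ r₀₂ :=
  conjugateEquiv (adj₀₁.comp adj₁₂) adj₀₂ (φ.map₂ ρ ≫ (φ.mapComp j₀₁ j₁₂).hom)

instance {a b c : I} {j₀₁ : c ⟶ b} {j₁₂ : b ⟶ a} {j₀₂ : c ⟶ a}
    {r₀₁ : φ.obj b ⟶ φ.obj c} {r₁₂ : φ.obj a ⟶ φ.obj b} {r₀₂ : φ.obj a ⟶ φ.obj c}
    (adj₀₁ : φ.map j₀₁ ⊣ r₀₁) (adj₁₂ : φ.map j₁₂ ⊣ r₁₂) (adj₀₂ : φ.map j₀₂ ⊣ r₀₂)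
    (ρ : j₀₂ ⟶ j₀₁ ≫ j₁₂) [IsIso ρ] : IsIso (totalMate φ adj₀₁ adj₁₂ adj₀₂ ρ) := by
  unfold totalMate
  infer_instance

/-- A choice of right adjoints `i^*` of the `1`-cells `i_! = φ(i)` for all `i` in the
`2`-subcategory `D`, such that the right adjoint chosen for `φ(𝟙) = 𝟙` is `𝟙`, with identity unit
(and hence, by the triangle identities, with identity counit). -/
structure RightAdjointChoice (D : TwoSubcategory I) where
  /-- the right adjoint `i^*` -/
  right : ∀ {a b : I} (i : a ⟶ b), D.hom i → (φ.obj b ⟶ φ.obj a)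
  /-- the adjunction between `i_!` and `i^*` -/
  adj : ∀ {a b : I} (i : a ⟶ b) (hi : D.hom i), φ.map i ⊣ right i hi
  right_id : ∀ (a : I) (h : D.hom (𝟙 a)), right (𝟙 a) h = 𝟙 (φ.obj a)
  unit_id : ∀ (a : I) (h : D.hom (𝟙 a)),
    (adj (𝟙 a) h).unit ≫ (φ.mapId a).hom ▷ right (𝟙 a) h ≫ (λ_ _).hom ≫
      eqToHom (right_id a h) = 𝟙 (𝟙 (φ.obj a))

variable {φ} {D : TwoSubcategory I}

/-- The `2`-cell `g₀₂_! j₀₂^* ⟹ (g₁₂_! i^*) (f_! j₁₂^*)` obtained by pasting `(ρ^*)⁻¹`, `σ_◊` and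
`τ_!`, for `ρ : j₀₂ ⟹ j₁₂ j₀₁`, `σ : i g₀₁ ⟹ f j₀₁` and `τ : g₀₂ ⟹ g₁₂ g₀₁`. -/
noncomputable def RightAdjointChoice.pasting (R : RightAdjointChoice φ D) {A B E F G H : I}
    {j₁₂ : B ⟶ A} {j₀₁ : G ⟶ B} {j₀₂ : G ⟶ A} {f : B ⟶ F} {i : H ⟶ F}
    {g₀₁ : G ⟶ H} {g₁₂ : H ⟶ E} {g₀₂ : G ⟶ E}
    (h₁₂ : D.hom j₁₂) (h₀₁ : D.hom j₀₁) (h₀₂ : D.hom j₀₂) (hi : D.hom i)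
    (ρ : j₀₂ ⟶ j₀₁ ≫ j₁₂) [IsIso ρ] (σ : g₀₁ ≫ i ⟶ j₀₁ ≫ f) (τ : g₀₂ ⟶ g₀₁ ≫ g₁₂) :
    R.right j₀₂ h₀₂ ≫ φ.map g₀₂ ⟶
      (R.right j₁₂ h₁₂ ≫ φ.map f) ≫ R.right i hi ≫ φ.map g₁₂ :=
  inv (totalMate φ (R.adj j₀₁ h₀₁) (R.adj j₁₂ h₁₂) (R.adj j₀₂ h₀₂) ρ) ▷ φ.map g₀₂ ≫
    (R.right j₁₂ h₁₂ ≫ R.right j₀₁ h₀₁) ◁ (φ.map₂ τ ≫ (φ.mapComp g₀₁ g₁₂).hom) ⊗≫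
    R.right j₁₂ h₁₂ ◁ canonicalMate φ (R.adj j₀₁ h₀₁) (R.adj i hi) σ ▷ φ.map g₁₂ ⊗≫
    𝟙 _

variable [IsLocallyGroupoid I]

/-- For a square in `I` with upper edge `g`, lower edge `f`, left edge `j` and right edge `i`, the
invertible `2`-cell `i g ⟹ f j` obtained by pasting the `2`-cells of its two triangles. -/
noncomputable def NormalDiagram.squareCell (S : NormalDiagram SquareShape I) :
    S.map (i := (0, 0)) (j := (1, 0)) (by decide) ≫ S.map (i := (1, 0)) (j := (1, 1)) (by decide) ⟶
      S.map (i := (0, 0)) (j := (0, 1)) (by decide) ≫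
        S.map (i := (0, 1)) (j := (1, 1)) (by decide) :=
  inv (S.comp (i := (0, 0)) (j := (1, 0)) (k := (1, 1)) (by decide) (by decide)) ≫
    S.comp (i := (0, 0)) (j := (0, 1)) (k := (1, 1)) (by decide) (by decide)

variable (φ D) in
/-- The Beck–Chevalley condition: for every pullback square in `N_Δ(I)` with vertical edges `j`, `i`
in `D`, the canonical mate `g_! j^* ⟹ i^* f_!` is invertible. -/
def BeckChevalley : Prop :=
  ∀ S : NormalDiagram SquareShape I, IsPullbackSquare S.toNerve →
    D.hom (S.map (i := (0, 0)) (j := (0, 1)) (by decide)) →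
    D.hom (S.map (i := (1, 0)) (j := (1, 1)) (by decide)) →
    ∀ {rj : φ.obj (S.obj (0, 1)) ⟶ φ.obj (S.obj (0, 0))}
      {ri : φ.obj (S.obj (1, 1)) ⟶ φ.obj (S.obj (1, 0))}
      (adj_j : φ.map (S.map (i := (0, 0)) (j := (0, 1)) (by decide)) ⊣ rj)
      (adj_i : φ.map (S.map (i := (1, 0)) (j := (1, 1)) (by decide)) ⊣ ri),
      IsIso (canonicalMate φ adj_j adj_i S.squareCell)

/-- For a `2`-simplex of the effective Burnside category of `I`, given by a normal diagram `Y`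
with ambigressive pullback square, the `2`-cell of `C` obtained by pasting mates. -/
noncomputable def RightAdjointChoice.cell (R : RightAdjointChoice φ D)
    (Y : NormalDiagram (TwOp 2) I)
    (hY : IsCartesianDiagram (⊤ : (duskinNerve I).Subcomplex) D.nerve Y.toNerve) :=
  R.pasting
    (hY.hom_mem (i := 0) (l := 0) (j := 1) (by decide) (by decide))
    (hY.hom_mem (i := 0) (l := 1) (j := 2) (by decide) (by decide))
    (hY.hom_mem (i := 0) (l := 0) (j := 2) (by decide) (by decide))
    (hY.hom_mem (i := 1) (l := 1) (j := 2) (by decide) (by decide))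
    (Y.comp (i := tw 0 2) (j := tw 0 1) (k := tw 0 0) (by decide) (by decide))
    (inv (Y.comp (i := tw 0 2) (j := tw 1 2) (k := tw 1 1) (by decide) (by decide)) ≫
      Y.comp (i := tw 0 2) (j := tw 0 1) (k := tw 1 1) (by decide) (by decide))
    (Y.comp (i := tw 0 2) (j := tw 1 2) (k := tw 2 2) (by decide) (by decide))

end Mates

/-! A simplex of the effective Burnside category amounts to a normal diagram on `TwOp n`
(`ofNerve`); let `Z` be its image under `φ`. The pair `i ≤ j` yields the `1`-cell `hom`: the right
adjoint of the backward leg, followed by the forward leg. A `2`-cell out of such a composite is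
determined by its transpose along the unit (`whiskerUnit_cancel`), so coherence can be checked on
transposes and mates never have to be composed with each other.

For `x ≤ (i ≤ j)` the adjunction gives a `2`-cell `unit` from `x → (j ≤ j)` to the composite of `x →
(i ≤ i)` with `hom`, natural in `x`. The pasting in the statement transposes, over `x = (i ≤ k)`, to
the unit of `j ≤ k` followed by that of `i ≤ j` (`whiskerUnit_pasting`, `isCell_cellAt`); by
naturality this persists over every smaller `x`. Over `(i ≤ l)` both sides of the coherence
condition for `i ≤ j ≤ k ≤ l` therefore transpose to the same pasting of the units of `k ≤ l`, `j ≤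
k` and `i ≤ j` (`IsCell.coherence`). Normality follows because the unit of an identity adjunction is
trivial. The Beck–Chevalley condition is needed only to make the cells invertible.

Uniqueness holds because a simplex of a Duskin nerve is determined by its restrictions to `[2]`
(`ext_of_restrict`), and the values on `2`-simplices are prescribed. -/

/-! ### Normal diagrams and maps into the Duskin nerve -/

section Coskeletal

variable {P Q : Type} [Preorder P] [Preorder Q] {B : Type u} [Bicategory.{w, v} B]

namespace Fin

/-- The pair `i ≤ j` as a monotone map. -/
def monoPair {i j : P} (h : i ≤ j) : Fin 2 →o P where
  toFun
    | 0 => i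
    | 1 => j
  monotone' := by
    intro a b hab
    fin_cases a <;> fin_cases b <;> first | exact le_rfl | exact h | exact absurd hab (by decide)

/-- The chain `i ≤ j ≤ k` as a monotone map. -/
def monoTriple {i j k : P} (h : i ≤ j) (h' : j ≤ k) : Fin 3 →o P where
  toFun
    | 0 => i
    | 1 => j
    | 2 => k
  monotone' := by
    intro a b hab
    fin_cases a <;> fin_cases b <;>
      first | exact le_rfl | exact h | exact h' | exact h.trans h' | exact absurd hab (by decide)

/-- The chain `i ≤ j ≤ k ≤ l` as a monotone map. -/
def monoQuadruple {i j k l : P} (h : i ≤ j) (h' : j ≤ k) (h'' : k ≤ l) : Fin 4 →o P where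
  toFun
    | 0 => i
    | 1 => j
    | 2 => k
    | 3 => l
  monotone' := by
    intro a b hab
    fin_cases a <;> fin_cases b <;>
      first | exact le_rfl | exact h | exact h' | exact h'' | exact h.trans h' |
        exact h'.trans h'' | exact (h.trans h').trans h'' | exact absurd hab (by decide)

end Fin

namespace NormalDiagram

theorem map_heq_of_eq {Y Y' : NormalDiagram P B} (e : Y = Y') {i j : P} (h : i ≤ j) :
    HEq (Y.map h) (Y'.map h) := by
  cases e; rfl

theorem comp_heq_of_eq {Y Y' : NormalDiagram P B} (e : Y = Y') {i j k : P} (h : i ≤ j)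
    (h' : j ≤ k) : HEq (Y.comp h h') (Y'.comp h h') := by
  cases e; rfl

theorem ext_of_heq {Y Y' : NormalDiagram P B} (ho : ∀ i, Y.obj i = Y'.obj i)
    (hm : ∀ {i j : P} (h : i ≤ j), HEq (Y.map h) (Y'.map h))
    (hc : ∀ {i j k : P} (h : i ≤ j) (h' : j ≤ k), HEq (Y.comp h h') (Y'.comp h h')) :
    Y = Y' := by
  obtain ⟨o, m, _, c, _, _, _⟩ := Y
  obtain ⟨o', m', _, c', _, _, _⟩ := Y'
  obtain rfl : o = o' := funext ho
  obtain rfl : @m = @m' := by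
    funext i j h
    exact eq_of_heq (hm h)
  obtain rfl : @c = @c' := by
    funext i j k h h'
    exact eq_of_heq (hc h h')
  rfl

/-- A normal diagram is determined by its restrictions to chains of length three. -/
theorem ext_of_restrict {Y Y' : NormalDiagram P B}
    (h : ∀ f : Fin 3 →o P, Y.restrict f = Y'.restrict f) : Y = Y' :=
  ext_of_heq
    (fun i => congrFun (congrArg NormalDiagram.obj (h (OrderHom.const _ i))) 0)
    (fun p => map_heq_of_eq (h (Fin.monoTriple p le_rfl)) (i := 0) (j := 1) (by decide))
    (fun p q => comp_heq_of_eq (h (Fin.monoTriple p q)) (i := 0) (j := 1) (k := 2)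
      (by decide) (by decide))

theorem toNerve_injective :
    Function.Injective (NormalDiagram.toNerve (P := P) (B := B)) := by
  intro Y Y' h
  refine ext_of_restrict fun f => ?_
  exact congrArg (fun s : ordNerve P ⟶ duskinNerve B =>
    s.app (op (SimplexCategory.mk 2)) ⟨f⟩) h

/-- The axioms of a normal diagram with given objects, `1`-cells and `2`-cells. -/
def IsNormal (o : Q → B) (m : ∀ {i j : Q}, i ≤ j → (o i ⟶ o j))
    (c : ∀ {i j k : Q} (hij : i ≤ j) (hjk : j ≤ k), m (hij.trans hjk) ⟶ m hij ≫ m hjk) : Prop :=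
  ∃ mr : ∀ i : Q, m (le_refl i) = 𝟙 (o i),
    (∀ {i j : Q} (hij : i ≤ j),
      c (le_refl i) hij ≫ eqToHom (mr i) ▷ m hij ≫ (λ_ (m hij)).hom = 𝟙 (m hij)) ∧
    (∀ {i j : Q} (hij : i ≤ j),
      c hij (le_refl j) ≫ m hij ◁ eqToHom (mr j) ≫ (ρ_ (m hij)).hom = 𝟙 (m hij)) ∧
    ∀ {i j k l : Q} (hij : i ≤ j) (hjk : j ≤ k) (hkl : k ≤ l),
      c (hij.trans hjk) hkl ≫ c hij hjk ▷ m hkl ≫ (α_ _ _ _).hom =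
        c hij (hjk.trans hkl) ≫ m hij ◁ c hjk hkl

/-- Transports all axioms at once, so that no equation between `2`-cells has to be rewritten along
casts. -/
theorem isNormal_of_heq (T : NormalDiagram Q B) {o : Q → B}
    {m : ∀ {i j : Q}, i ≤ j → (o i ⟶ o j)}
    {c : ∀ {i j k : Q} (hij : i ≤ j) (hjk : j ≤ k), m (hij.trans hjk) ⟶ m hij ≫ m hjk}
    (ho : ∀ i, T.obj i = o i)
    (hm : ∀ {i j : Q} (h : i ≤ j), HEq (T.map h) (m h))
    (hc : ∀ {i j k : Q} (h : i ≤ j) (h' : j ≤ k), HEq (T.comp h h') (c h h')) :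
    IsNormal o m c := by
  obtain ⟨o', m', h₁, c', h₂, h₃, h₄⟩ := T
  obtain rfl : o' = o := funext ho
  obtain rfl : @m' = @m := by
    funext i j h
    exact eq_of_heq (hm h)
  obtain rfl : @c' = @c := by
    funext i j k h h'
    exact eq_of_heq (hc h h')
  exact ⟨h₁, h₂, h₃, h₄⟩

/-! ### Recovering a normal diagram from a map of simplicial sets -/

section OfNerve

variable (s : ordNerve.{max u v w} P ⟶ duskinNerve B)

/-- The simplex of the Duskin nerve that is the image of a chain in `P`. -/
def simplexOfNerve {m : ℕ} (x : Fin (m + 1) →o P) : NormalDiagram (Fin (m + 1)) B :=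
  s.app (op (SimplexCategory.mk m)) ⟨x⟩

theorem simplexOfNerve_comp {m n : ℕ} (x : Fin (n + 1) →o P) (f : Fin (m + 1) →o Fin (n + 1)) :
    simplexOfNerve s (x.comp f) = (simplexOfNerve s x).restrict f := by
  have h := NatTrans.naturality_apply s (SimplexCategory.mkHom f).op ⟨x⟩
  exact h

/-- By naturality, a cell of a simplex depends only on the subchain of `P` that it spans. This and
the next two lemmas record it for objects, `1`-cells and `2`-cells; equalities of objects force
`HEq` in the latter two. -/
theorem simplexOfNerve_obj {n : ℕ} (x : Fin (n + 1) →o P) (a : Fin (n + 1)) :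
    (simplexOfNerve s x).obj a =
      (simplexOfNerve s (OrderHom.const (Fin 1) (x a))).obj 0 :=
  (congrFun (congrArg NormalDiagram.obj
    (simplexOfNerve_comp s x (OrderHom.const (Fin 1) a))) 0).symm

theorem simplexOfNerve_map {n : ℕ} (x : Fin (n + 1) →o P) {a b : Fin (n + 1)} (h : a ≤ b) :
    HEq ((simplexOfNerve s x).map h)
      ((simplexOfNerve s (Fin.monoPair (x.monotone h))).map
        (i := (0 : Fin 2)) (j := (1 : Fin 2)) (by decide)) := by
  have e : x.comp (Fin.monoPair h) = Fin.monoPair (x.monotone h) := by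
    apply OrderHom.ext
    funext c
    fin_cases c <;> rfl
  have h' := simplexOfNerve_comp s x (Fin.monoPair h)
  rw [e] at h'
  exact (map_heq_of_eq h' (i := (0 : Fin 2)) (j := (1 : Fin 2)) (by decide)).symm

theorem simplexOfNerve_comp_cell {n : ℕ} (x : Fin (n + 1) →o P) {a b c : Fin (n + 1)}
    (h : a ≤ b) (h' : b ≤ c) :
    HEq ((simplexOfNerve s x).comp h h')
      ((simplexOfNerve s (Fin.monoTriple (x.monotone h) (x.monotone h'))).comp
        (i := (0 : Fin 3)) (j := (1 : Fin 3)) (k := (2 : Fin 3)) (by decide) (by decide)) := by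
  have e : x.comp (Fin.monoTriple h h') = Fin.monoTriple (x.monotone h) (x.monotone h') := by
    apply OrderHom.ext
    funext c
    fin_cases c <;> rfl
  have h'' := simplexOfNerve_comp s x (Fin.monoTriple h h')
  rw [e] at h''
  exact (comp_heq_of_eq h'' (i := (0 : Fin 3)) (j := (1 : Fin 3)) (k := (2 : Fin 3))
    (by decide) (by decide)).symm

/-- The objects of `ofNerve`. -/
def nerveObj (i : P) : B := (simplexOfNerve s (OrderHom.const (Fin 1) i)).obj 0

/-- The `1`-cells of `ofNerve`. -/
def nerveMap {i j : P} (h : i ≤ j) : nerveObj s i ⟶ nerveObj s j :=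
  cast (congrArg₂ (· ⟶ ·) (simplexOfNerve_obj s (Fin.monoPair h) 0)
    (simplexOfNerve_obj s (Fin.monoPair h) 1))
    ((simplexOfNerve s (Fin.monoPair h)).map (i := (0 : Fin 2)) (j := (1 : Fin 2)) (by decide))

theorem nerveMap_heq {n : ℕ} (x : Fin (n + 1) →o P) {a b : Fin (n + 1)} (h : a ≤ b) :
    HEq ((simplexOfNerve s x).map h) (nerveMap s (x.monotone h)) :=
  (simplexOfNerve_map s x h).trans (cast_heq _ _).symm

theorem hom₂_type_congr {a b c a' b' c' : B} (ha : a = a') (hb : b = b') (hc : c = c')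
    {f : a ⟶ b} {f' : a' ⟶ b'} (hf : HEq f f') {g : b ⟶ c} {g' : b' ⟶ c'} (hg : HEq g g')
    {h : a ⟶ c} {h' : a' ⟶ c'} (hh : HEq h h') :
    (h ⟶ f ≫ g) = (h' ⟶ f' ≫ g') := by
  subst ha hb hc
  cases hf
  cases hg
  cases hh
  rfl

/-- The `2`-cells of `ofNerve`. -/
def nerveComp {i j k : P} (h : i ≤ j) (h' : j ≤ k) :
    nerveMap s (h.trans h') ⟶ nerveMap s h ≫ nerveMap s h' :=
  cast (hom₂_type_congr (simplexOfNerve_obj s (Fin.monoTriple h h') 0)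
    (simplexOfNerve_obj s (Fin.monoTriple h h') 1) (simplexOfNerve_obj s (Fin.monoTriple h h') 2)
    (nerveMap_heq s (Fin.monoTriple h h') _) (nerveMap_heq s (Fin.monoTriple h h') _)
    (nerveMap_heq s (Fin.monoTriple h h') _))
    ((simplexOfNerve s (Fin.monoTriple h h')).comp
      (i := (0 : Fin 3)) (j := (1 : Fin 3)) (k := (2 : Fin 3)) (by decide) (by decide))

theorem nerveComp_heq {n : ℕ} (x : Fin (n + 1) →o P) {a b c : Fin (n + 1)} (h : a ≤ b)
    (h' : b ≤ c) :
    HEq ((simplexOfNerve s x).comp h h') (nerveComp s (x.monotone h) (x.monotone h')) :=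
  (simplexOfNerve_comp_cell s x h h').trans (cast_heq _ _).symm

theorem isNormal_nerve {n : ℕ} (x : Fin (n + 1) →o P) :
    IsNormal (fun a => nerveObj s (x a)) (fun h => nerveMap s (x.monotone h))
      (fun h h' => nerveComp s (x.monotone h) (x.monotone h')) :=
  isNormal_of_heq (simplexOfNerve s x) (simplexOfNerve_obj s x) (nerveMap_heq s x)
    (nerveComp_heq s x)

/-- The normal diagram that corresponds to a map into the Duskin nerve. -/
def ofNerve : NormalDiagram P B where
  obj := nerveObj s
  map := nerveMap s
  -- Each axiom is read off on a chain that carries its indices: one, two or four elements.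
  map_refl i := (isNormal_nerve s (OrderHom.const (Fin 1) i)).choose 0
  comp := nerveComp s
  comp_refl_left h :=
    (isNormal_nerve s (Fin.monoPair h)).choose_spec.1 (i := (0 : Fin 2)) (j := (1 : Fin 2))
      (by decide)
  comp_refl_right h :=
    (isNormal_nerve s (Fin.monoPair h)).choose_spec.2.1 (i := (0 : Fin 2)) (j := (1 : Fin 2))
      (by decide)
  comp_assoc h h' h'' :=
    (isNormal_nerve s (Fin.monoQuadruple h h' h'')).choose_spec.2.2 (i := (0 : Fin 4))
      (j := (1 : Fin 4)) (k := (2 : Fin 4)) (l := (3 : Fin 4)) (by decide) (by decide) (by decide)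

@[simp]
theorem toNerve_ofNerve : (ofNerve s).toNerve = s := by
  ext m x
  exact (ext_of_heq (Y := simplexOfNerve s x.down) (Y' := (ofNerve s).restrict x.down)
    (simplexOfNerve_obj s x.down) (nerveMap_heq s x.down) (nerveComp_heq s x.down)).symm

end OfNerve

@[simp]
theorem ofNerve_toNerve (Y : NormalDiagram P B) : ofNerve Y.toNerve = Y :=
  toNerve_injective (toNerve_ofNerve _)

theorem toNerve_restrict (Y : NormalDiagram Q B) (f : P →o Q) :
    (Y.restrict f).toNerve = ordNerve.map f ≫ Y.toNerve := rfl

/-- A `2`-simplex of the Duskin nerve is determined by its three edges and its `2`-cell. -/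
theorem eq_triangle (Y : NormalDiagram (Fin 3) B) :
    Y = triangle (Y.comp (i := 0) (j := 1) (k := 2) (by decide) (by decide)) := by
  -- Normality forces the cells at degenerate pairs to be inverse unitors. The variable `g` covers
  -- the case in which `Y.map h` is an identity only propositionally.
  have hl : ∀ {i j : Fin 3} (h : i ≤ j) {g : Y.obj i ⟶ Y.obj j}, Y.map h = g →
      HEq (Y.comp (le_refl i) h) (λ_ g).inv := by
    rintro i j h g rfl
    have e : Y.comp (le_refl i) h =
        (λ_ (Y.map h)).inv ≫ eqToHom (Y.map_refl i).symm ▷ Y.map h := by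
      rw [← cancel_mono (eqToHom (Y.map_refl i) ▷ Y.map h ≫ (λ_ (Y.map h)).hom),
        Y.comp_refl_left h]
      simp
    have key : ∀ {f : Y.obj i ⟶ Y.obj i} (hf : f = 𝟙 _),
        HEq ((λ_ (Y.map h)).inv ≫ eqToHom hf.symm ▷ Y.map h) (λ_ (Y.map h)).inv := by
      rintro f rfl
      simp
    exact (heq_of_eq e).trans (key (Y.map_refl i))
  have hr : ∀ {i j : Fin 3} (h : i ≤ j) {g : Y.obj i ⟶ Y.obj j}, Y.map h = g →
      HEq (Y.comp h (le_refl j)) (ρ_ g).inv := by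
    rintro i j h g rfl
    have e : Y.comp h (le_refl j) =
        (ρ_ (Y.map h)).inv ≫ Y.map h ◁ eqToHom (Y.map_refl j).symm := by
      rw [← cancel_mono (Y.map h ◁ eqToHom (Y.map_refl j) ≫ (ρ_ (Y.map h)).hom),
        Y.comp_refl_right h]
      simp
    have key : ∀ {f : Y.obj j ⟶ Y.obj j} (hf : f = 𝟙 _),
        HEq ((ρ_ (Y.map h)).inv ≫ Y.map h ◁ eqToHom hf.symm) (ρ_ (Y.map h)).inv := by
      rintro f rfl
      simp
    exact (heq_of_eq e).trans (key (Y.map_refl j))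
  refine ext_of_heq (fun i => ?_) (fun {i j} h => ?_) (fun {i j k} h h' => ?_)
  · fin_cases i <;> rfl
  · fin_cases i <;> fin_cases j <;>
      first | exact absurd h (by decide) | exact HEq.rfl | exact heq_of_eq (Y.map_refl _)
  · fin_cases i <;> fin_cases j <;> first | exact absurd h (by decide) | skip
    all_goals fin_cases k <;>
      first | exact absurd h' (by decide) | exact HEq.rfl | exact hl h' rfl |
        exact hl h' (Y.map_refl _) | exact hr h rfl

end NormalDiagram

end Coskeletal

/-! ### Transposition along the unit of an adjunction -/

section Transpose

variable {B : Type u} [Bicategory.{w, v} B]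

namespace CategoryTheory.Bicategory.Adjunction

/-- The unit of `l ⊣ r`, whiskered with `g`. -/
def whiskerUnit {a b d : B} {l : a ⟶ b} {r : b ⟶ a} (adj : l ⊣ r) (g : a ⟶ d) :
    g ⟶ l ≫ r ≫ g :=
  (λ_ _).inv ≫ adj.unit ▷ g ≫ (α_ _ _ _).hom

theorem homEquiv₁_symm_eq {a b d : B} {l : a ⟶ b} {r : b ⟶ a} (adj : l ⊣ r) {g : a ⟶ d}
    {h : b ⟶ d} (β : r ≫ g ⟶ h) :
    adj.homEquiv₁.symm β = adj.whiskerUnit g ≫ l ◁ β := by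
  simp [homEquiv₁_symm_apply, whiskerUnit]

/-- Transposition is a bijection; every uniqueness argument for cells below rests on this. -/
theorem whiskerUnit_cancel {a b d : B} {l : a ⟶ b} {r : b ⟶ a} (adj : l ⊣ r) {g : a ⟶ d}
    {h : b ⟶ d} {β γ : r ≫ g ⟶ h}
    (e : adj.whiskerUnit g ≫ l ◁ β = adj.whiskerUnit g ≫ l ◁ γ) : β = γ := by
  rw [← homEquiv₁_symm_eq, ← homEquiv₁_symm_eq] at e
  exact adj.homEquiv₁.symm.injective e

/-- The compatibility of a conjugate `2`-cell with the units. -/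
theorem unit_conjugateEquiv {a b : B} {l₁ l₂ : a ⟶ b} {r₁ r₂ : b ⟶ a} (adj₁ : l₁ ⊣ r₁)
    (adj₂ : l₂ ⊣ r₂) (ρ : l₂ ⟶ l₁) :
    adj₁.unit ≫ l₁ ◁ conjugateEquiv adj₁ adj₂ ρ = adj₂.unit ≫ ρ ▷ r₂ := by
  rw [conjugateEquiv_apply']
  calc
    _ = 𝟙 _ ⊗≫ (adj₁.unit ▷ 𝟙 a ≫ (l₁ ≫ r₁) ◁ (adj₂.unit ≫ ρ ▷ r₂)) ⊗≫
          l₁ ◁ adj₁.counit ▷ r₂ ⊗≫ 𝟙 _ := by bicategory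
    -- Interchange brings the second unit to the front and leaves the left zigzag of `adj₁`.
    _ = (adj₂.unit ≫ ρ ▷ r₂) ⊗≫ leftZigzag adj₁.unit adj₁.counit ▷ r₂ ⊗≫ 𝟙 _ := by
      rw [← whisker_exchange]; bicategory
    _ = _ := by
      rw [adj₁.left_triangle]; bicategory

/-- The pasting contains the inverse of a total mate; against the unit, it becomes the inverse of
`ρ` itself. -/
theorem unit_inv_conjugateEquiv {a b : B} {l₁ l₂ : a ⟶ b} {r₁ r₂ : b ⟶ a} (adj₁ : l₁ ⊣ r₁)
    (adj₂ : l₂ ⊣ r₂) (ρ : l₂ ⟶ l₁) [IsIso ρ] :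
    adj₂.unit ≫ l₂ ◁ inv (conjugateEquiv adj₁ adj₂ ρ) = adj₁.unit ≫ inv ρ ▷ r₁ := by
  rw [← cancel_mono (l₂ ◁ conjugateEquiv adj₁ adj₂ ρ), Category.assoc, Category.assoc,
    ← whisker_exchange, ← Category.assoc adj₁.unit, unit_conjugateEquiv]
  simp

/-- The compatibility of mates with units. -/
theorem unit_mateEquiv {c d e f : B} {g : c ⟶ e} {h : d ⟶ f} {l₁ : c ⟶ d} {r₁ : d ⟶ c}
    {l₂ : e ⟶ f} {r₂ : f ⟶ e} (adj₁ : l₁ ⊣ r₁) (adj₂ : l₂ ⊣ r₂) (σ : g ≫ l₂ ⟶ l₁ ≫ h) :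
    adj₁.whiskerUnit g ≫ l₁ ◁ mateEquiv adj₁ adj₂ σ =
      𝟙 _ ⊗≫ g ◁ adj₂.unit ⊗≫ σ ▷ r₂ ⊗≫ 𝟙 _ := by
  have h := (mateEquiv_eq_iff adj₁ adj₂ σ _).1 rfl
  rw [homEquiv₁_symm_eq] at h
  rw [h, homEquiv₂_apply]
  bicategory

end CategoryTheory.Bicategory.Adjunction

open CategoryTheory.Bicategory.Adjunction

/-- The transpose of the `2`-cell obtained by pasting the inverse of a conjugate `2`-cell, a mate
and a `2`-cell involves only units. -/
theorem whiskerUnit_pasting {A B' E F G H : B}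
    {l₁₂ : B' ⟶ A} {l₀₁ : G ⟶ B'} {l₀₂ : G ⟶ A} {f : B' ⟶ F} {l : H ⟶ F}
    {g₀₁ : G ⟶ H} {g₁₂ : H ⟶ E} {g₀₂ : G ⟶ E} {r₁₂ : A ⟶ B'} {r₀₁ : B' ⟶ G} {r₀₂ : A ⟶ G}
    {r : F ⟶ H} (adj₁₂ : l₁₂ ⊣ r₁₂) (adj₀₁ : l₀₁ ⊣ r₀₁) (adj₀₂ : l₀₂ ⊣ r₀₂) (adj : l ⊣ r)
    (ρ : l₀₂ ⟶ l₀₁ ≫ l₁₂) [IsIso ρ] (σ : g₀₁ ≫ l ⟶ l₀₁ ≫ f) (τ : g₀₂ ⟶ g₀₁ ≫ g₁₂) :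
    adj₀₂.whiskerUnit g₀₂ ≫ l₀₂ ◁ (inv (conjugateEquiv (adj₀₁.comp adj₁₂) adj₀₂ ρ) ▷ g₀₂ ≫
      (r₁₂ ≫ r₀₁) ◁ τ ⊗≫ r₁₂ ◁ mateEquiv adj₀₁ adj σ ▷ g₁₂ ⊗≫ 𝟙 _) =
    τ ≫ g₀₁ ◁ adj.whiskerUnit g₁₂ ≫ (α_ _ _ _).inv ≫ σ ▷ (r ≫ g₁₂) ≫ (α_ _ _ _).hom ≫
      l₀₁ ◁ (adj₁₂.whiskerUnit f ▷ (r ≫ g₁₂)) ⊗≫ inv ρ ▷ ((r₁₂ ≫ f) ≫ r ≫ g₁₂) := by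
  calc
    _ = 𝟙 _ ⊗≫ (adj₀₂.unit ≫ l₀₂ ◁ inv (conjugateEquiv (adj₀₁.comp adj₁₂) adj₀₂ ρ)) ▷ g₀₂ ⊗≫
        l₀₂ ◁ (r₁₂ ≫ r₀₁) ◁ τ ⊗≫ l₀₂ ◁ r₁₂ ◁ mateEquiv adj₀₁ adj σ ▷ g₁₂ ⊗≫ 𝟙 _ := by
      simp only [whiskerUnit]; bicategory
    -- The inverse conjugate is traded for `inv ρ`, which interchange then carries to the end.
    _ = 𝟙 _ ⊗≫ (adj₀₁.comp adj₁₂).unit ▷ g₀₂ ⊗≫ (inv ρ ▷ (r₁₂ ≫ r₀₁ ≫ g₀₂) ≫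
        l₀₂ ◁ (r₁₂ ◁ r₀₁ ◁ τ ⊗≫ r₁₂ ◁ mateEquiv adj₀₁ adj σ ▷ g₁₂)) ⊗≫ 𝟙 _ := by
      rw [unit_inv_conjugateEquiv]; bicategory
    _ = 𝟙 _ ⊗≫ adj₀₁.unit ▷ g₀₂ ⊗≫ l₀₁ ◁ (adj₁₂.unit ▷ (r₀₁ ≫ g₀₂) ≫ (l₁₂ ≫ r₁₂) ◁
        (r₀₁ ◁ τ ⊗≫ mateEquiv adj₀₁ adj σ ▷ g₁₂)) ⊗≫
        inv ρ ▷ ((r₁₂ ≫ f) ≫ r ≫ g₁₂) := by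
      rw [← whisker_exchange, Bicategory.Adjunction.comp_unit, Bicategory.Adjunction.compUnit]
      bicategory
    _ = 𝟙 _ ⊗≫ (adj₀₁.unit ▷ g₀₂ ≫ (l₀₁ ≫ r₀₁) ◁ τ) ⊗≫ l₀₁ ◁ mateEquiv adj₀₁ adj σ ▷ g₁₂ ⊗≫
        l₀₁ ◁ adj₁₂.unit ▷ (f ≫ r ≫ g₁₂) ⊗≫
        inv ρ ▷ ((r₁₂ ≫ f) ≫ r ≫ g₁₂) := by
      rw [← whisker_exchange]; bicategory
    -- Once `τ` is moved to the front, the unit of `adj₀₁` meets the mate and turns it back into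
    -- `σ`.
    _ = 𝟙 _ ⊗≫ τ ⊗≫ (adj₀₁.whiskerUnit g₀₁ ≫ l₀₁ ◁ mateEquiv adj₀₁ adj σ) ▷ g₁₂ ⊗≫
        l₀₁ ◁ adj₁₂.unit ▷ (f ≫ r ≫ g₁₂) ⊗≫
        inv ρ ▷ ((r₁₂ ≫ f) ≫ r ≫ g₁₂) := by
      rw [← whisker_exchange]; simp only [whiskerUnit]; bicategory
    _ = _ := by
      rw [Bicategory.Adjunction.unit_mateEquiv]; simp only [whiskerUnit]; bicategory

end Transpose

/-! ### Diagrams on the twisted arrow category -/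

section TwistedDiagram

variable {B : Type u} [Bicategory.{w, v} B] {n : ℕ} (Z : NormalDiagram (TwOp n) B)

/-- Right adjoints of the `1`-cells `(i ≤ j) → (i ≤ i)`. -/
structure NormalDiagram.RightAdjoints where
  /-- the right adjoint -/
  right : ∀ {i j : Fin (n + 1)} (h : i ≤ j), Z.obj (tw i i le_rfl) ⟶ Z.obj (tw i j h)
  /-- the adjunction -/
  adj : ∀ {i j : Fin (n + 1)} (h : i ≤ j), Z.map (tw_le h le_rfl le_rfl h) ⊣ right h

namespace NormalDiagram.RightAdjoints

variable {Z} (R : Z.RightAdjoints)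
  [∀ {x y z : TwOp n} (h : x ≤ y) (h' : y ≤ z), IsIso (Z.comp h h')]

/-- The `1`-cell obtained from the span `(i ≤ i) ← (i ≤ j) → (j ≤ j)`. -/
abbrev hom {i j : Fin (n + 1)} (h : i ≤ j) : Z.obj (tw i i le_rfl) ⟶ Z.obj (tw j j le_rfl) :=
  R.right h ≫ Z.map (tw_le h le_rfl h le_rfl)

theorem tw_le_left {x : TwOp n} {i j : Fin (n + 1)} {h : i ≤ j} (hx : x ≤ tw i j h) :
    x ≤ tw i i le_rfl :=
  hx.trans (tw_le h le_rfl le_rfl h)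

theorem tw_le_right {x : TwOp n} {i j : Fin (n + 1)} {h : i ≤ j} (hx : x ≤ tw i j h) :
    x ≤ tw j j le_rfl :=
  hx.trans (tw_le h le_rfl h le_rfl)

/-- The `2`-cell from `x → (j ≤ j)` to the composite of `x → (i ≤ i)` with `R.hom`. -/
noncomputable def unit {x : TwOp n} {i j : Fin (n + 1)} {h : i ≤ j} (hx : x ≤ tw i j h) :
    Z.map (tw_le_right hx) ⟶ Z.map (tw_le_left hx) ≫ R.hom h :=
  Z.comp hx (tw_le h le_rfl h le_rfl) ≫
    Z.map hx ◁ (R.adj h).whiskerUnit (Z.map (tw_le h le_rfl h le_rfl)) ≫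
    (α_ _ _ _).inv ≫ inv (Z.comp hx (tw_le h le_rfl le_rfl h)) ▷ R.hom h

/-- Naturality in `x` is what lets an identity over `(i ≤ k)` be restricted to smaller objects. -/
theorem unit_naturality {x y : TwOp n} {i j : Fin (n + 1)} {h : i ≤ j} (hx : x ≤ tw i j h)
    (hy : y ≤ x) :
    Z.comp hy (tw_le_right hx) ≫ Z.map hy ◁ R.unit hx ≫ (α_ _ _ _).inv =
      R.unit (hy.trans hx) ≫ Z.comp hy (tw_le_left hx) ▷ R.hom h := by
  have h₁ := Z.comp_assoc hy hx (tw_le h le_rfl h le_rfl)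
  -- The coherence of `Z` along the backward leg, solved for the inverse `2`-cell; `h₁` is the one
  -- along the forward leg.
  have h₂ : inv (Z.comp (hy.trans hx) (tw_le h le_rfl le_rfl h)) ≫ Z.comp hy (tw_le_left hx) =
      Z.comp hy hx ▷ _ ≫ (α_ _ _ _).hom ≫
        Z.map hy ◁ inv (Z.comp hx (tw_le h le_rfl le_rfl h)) := by
    rw [IsIso.inv_comp_eq, ← cancel_mono (Z.map hy ◁ Z.comp hx (tw_le h le_rfl le_rfl h)),
      ← Z.comp_assoc hy hx (tw_le h le_rfl le_rfl h)]
    simp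
  calc
    _ = (Z.comp hy (tw_le_right hx) ≫ Z.map hy ◁ Z.comp hx (tw_le h le_rfl h le_rfl)) ≫
          Z.map hy ◁ Z.map hx ◁ (R.adj h).whiskerUnit (Z.map (tw_le h le_rfl h le_rfl)) ⊗≫
          Z.map hy ◁ inv (Z.comp hx (tw_le h le_rfl le_rfl h)) ▷ R.hom h ≫ (α_ _ _ _).inv := by
      simp only [unit]; bicategory
    _ = Z.comp (hy.trans hx) (tw_le h le_rfl h le_rfl) ≫ (Z.comp hy hx ▷ _ ≫
          (Z.map hy ≫ Z.map hx) ◁ (R.adj h).whiskerUnit (Z.map (tw_le h le_rfl h le_rfl))) ⊗≫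
          Z.map hy ◁ inv (Z.comp hx (tw_le h le_rfl le_rfl h)) ▷ R.hom h ≫ (α_ _ _ _).inv := by
      rw [← h₁]; bicategory
    _ = Z.comp (hy.trans hx) (tw_le h le_rfl h le_rfl) ≫
          Z.map (hy.trans hx) ◁ (R.adj h).whiskerUnit (Z.map (tw_le h le_rfl h le_rfl)) ⊗≫
          (Z.comp hy hx ▷ _ ≫ (α_ _ _ _).hom ≫
            Z.map hy ◁ inv (Z.comp hx (tw_le h le_rfl le_rfl h))) ▷ R.hom h := by
      rw [← whisker_exchange]; simp only [hom]; bicategory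
    _ = _ := by
      rw [← h₂]; simp only [unit]; bicategory

/-- Over `(i ≤ j)` itself the two comparison cells of `Z` cancel by normality, so `unit` is a plain
transposition unit and can be cancelled. -/
theorem unit_refl {i j : Fin (n + 1)} (h : i ≤ j) :
    R.unit (le_refl (tw i j h)) =
      (R.adj h).whiskerUnit (Z.map (tw_le h le_rfl h le_rfl)) := by
  have h₁ : R.unit (le_refl (tw i j h)) =
      (Z.comp (le_refl (tw i j h)) (tw_le h le_rfl h le_rfl) ≫ eqToHom (Z.map_refl _) ▷ _ ≫
        (λ_ _).hom) ≫ (R.adj h).whiskerUnit (Z.map (tw_le h le_rfl h le_rfl)) := by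
    have h₂ : inv (Z.comp (le_refl (tw i j h)) (tw_le h le_rfl le_rfl h)) =
        eqToHom (Z.map_refl _) ▷ _ ≫ (λ_ _).hom :=
      IsIso.inv_eq_of_hom_inv_id (Z.comp_refl_left _)
    rw [unit, h₂]
    -- The degenerate `1`-cell is made a variable so that its equation with the identity can be
    -- eliminated.
    generalize Z.comp (le_refl (tw i j h)) (tw_le h le_rfl h le_rfl) = c
    generalize Z.map_refl (tw i j h) = e
    revert c e
    generalize Z.map (le_refl (tw i j h)) = m
    rintro c rfl
    simp only [eqToHom_refl]
    bicategory
  rw [h₁, Z.comp_refl_left]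
  exact Category.id_comp _

theorem unit_cancel {i j : Fin (n + 1)} {h : i ≤ j}
    {g : Z.obj (tw i i le_rfl) ⟶ Z.obj (tw j j le_rfl)} {β γ : R.hom h ⟶ g}
    (e : R.unit (le_refl (tw i j h)) ≫ Z.map (tw_le_left (le_refl (tw i j h))) ◁ β =
      R.unit (le_refl (tw i j h)) ≫ Z.map (tw_le_left (le_refl (tw i j h))) ◁ γ) : β = γ := by
  rw [unit_refl] at e
  exact (R.adj h).whiskerUnit_cancel e

/-- The property that characterizes the `2`-cells of the unfurled diagram. -/
def IsCell {i j k : Fin (n + 1)} (hij : i ≤ j) (hjk : j ≤ k)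
    (θ : R.hom (hij.trans hjk) ⟶ R.hom hij ≫ R.hom hjk) : Prop :=
  R.unit (le_refl (tw i k (hij.trans hjk))) ≫
      Z.map (tw_le_left (le_refl (tw i k (hij.trans hjk)))) ◁ θ =
    R.unit (tw_le (hij.trans hjk) hjk hij le_rfl) ≫
      R.unit (tw_le (hij.trans hjk) hij le_rfl hjk) ▷ R.hom hjk ≫ (α_ _ _ _).hom

/-- The defining identity over `(i ≤ k)` is whiskered with `x → (i ≤ k)`, and each of the three
units is moved across by naturality. -/
theorem IsCell.unit_comp {R : Z.RightAdjoints} {i j k : Fin (n + 1)} {hij : i ≤ j} {hjk : j ≤ k}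
    {θ : R.hom (hij.trans hjk) ⟶ R.hom hij ≫ R.hom hjk} (hθ : R.IsCell hij hjk θ)
    {x : TwOp n} (hx : x ≤ tw i k (hij.trans hjk)) :
    R.unit hx ≫ Z.map (tw_le_left hx) ◁ θ =
      R.unit (hx.trans (tw_le (hij.trans hjk) hjk hij le_rfl)) ≫
        R.unit (hx.trans (tw_le (hij.trans hjk) hij le_rfl hjk)) ▷ R.hom hjk ≫ (α_ _ _ _).hom := by
  set a := tw_le_left (le_refl (tw i k (hij.trans hjk)))
  set a' := tw_le_right (le_refl (tw i k (hij.trans hjk)))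
  set b := tw_le_right (tw_le (hij.trans hjk) hij le_rfl hjk)
  have n₁ := R.unit_naturality (le_refl (tw i k (hij.trans hjk))) hx
  have n₂ := R.unit_naturality (tw_le (hij.trans hjk) hjk hij le_rfl) hx
  have n₃ := R.unit_naturality (tw_le (hij.trans hjk) hij le_rfl hjk) hx
  rw [← cancel_mono (Z.comp hx a ▷ (R.hom hij ≫ R.hom hjk))]
  calc
    _ = (R.unit hx ≫ Z.comp hx a ▷ R.hom (hij.trans hjk)) ≫ (Z.map hx ≫ Z.map a) ◁ θ := by
      rw [Category.assoc, Category.assoc, whisker_exchange]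
    _ = Z.comp hx a' ≫ Z.map hx ◁ (R.unit (le_refl (tw i k (hij.trans hjk))) ≫
          Z.map a ◁ θ) ≫ (α_ _ _ _).inv := by
      rw [← n₁]; bicategory
    _ = (Z.comp hx a' ≫ Z.map hx ◁ R.unit (tw_le (hij.trans hjk) hjk hij le_rfl) ≫
          (α_ _ _ _).inv) ≫ (α_ _ _ _).hom ≫
            Z.map hx ◁ R.unit (tw_le (hij.trans hjk) hij le_rfl hjk) ▷ R.hom hjk ⊗≫ 𝟙 _ := by
      rw [hθ]; bicategory
    _ = R.unit (hx.trans (tw_le (hij.trans hjk) hjk hij le_rfl)) ≫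
          (Z.comp hx b ≫ Z.map hx ◁ R.unit (tw_le (hij.trans hjk) hij le_rfl hjk) ≫
          (α_ _ _ _).inv) ▷ R.hom hjk ⊗≫ 𝟙 _ := by
      rw [n₂]; bicategory
    _ = _ := by
      rw [n₃]; bicategory

theorem IsCell.coherence {R : Z.RightAdjoints} {i j k l : Fin (n + 1)} {hij : i ≤ j} {hjk : j ≤ k}
    {hkl : k ≤ l} {θ₁ : R.hom ((hij.trans hjk).trans hkl) ⟶ R.hom (hij.trans hjk) ≫ R.hom hkl}
    {θ₂ : R.hom (hij.trans hjk) ⟶ R.hom hij ≫ R.hom hjk}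
    {θ₃ : R.hom (hij.trans (hjk.trans hkl)) ⟶ R.hom hij ≫ R.hom (hjk.trans hkl)}
    {θ₄ : R.hom (hjk.trans hkl) ⟶ R.hom hjk ≫ R.hom hkl}
    (h₁ : R.IsCell (hij.trans hjk) hkl θ₁) (h₂ : R.IsCell hij hjk θ₂)
    (h₃ : R.IsCell hij (hjk.trans hkl) θ₃) (h₄ : R.IsCell hjk hkl θ₄) :
    θ₁ ≫ θ₂ ▷ R.hom hkl ≫ (α_ _ _ _).hom = θ₃ ≫ R.hom hij ◁ θ₄ := by
  -- Everything is compared over the initial object `(i ≤ l)`, where the transposes of both sides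
  -- are pastings of the units of `k ≤ l`, `j ≤ k`, `i ≤ j`.
  set x := tw i l ((hij.trans hjk).trans hkl)
  have hil : x ≤ tw i l ((hij.trans hjk).trans hkl) := le_rfl
  have hik : x ≤ tw i k (hij.trans hjk) := tw_le _ _ le_rfl hkl
  have hjl : x ≤ tw j l (hjk.trans hkl) := tw_le _ _ hij le_rfl
  have hij' : x ≤ tw i j hij := tw_le _ _ le_rfl (hjk.trans hkl)
  have hjk' : x ≤ tw j k hjk := tw_le _ _ hij hkl
  have hkl' : x ≤ tw k l hkl := tw_le _ _ (hij.trans hjk) le_rfl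
  have e₁ : R.unit hil ≫ Z.map (tw_le_left hil) ◁ θ₁ =
      R.unit hkl' ≫ R.unit hik ▷ R.hom hkl ≫ (α_ _ _ _).hom := h₁.unit_comp hil
  have e₂ : R.unit hik ≫ Z.map (tw_le_left hil) ◁ θ₂ =
      R.unit hjk' ≫ R.unit hij' ▷ R.hom hjk ≫ (α_ _ _ _).hom := h₂.unit_comp hik
  have e₃ : R.unit hil ≫ Z.map (tw_le_left hil) ◁ θ₃ =
      R.unit hjl ≫ R.unit hij' ▷ R.hom (hjk.trans hkl) ≫ (α_ _ _ _).hom := h₃.unit_comp hil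
  have e₄ : R.unit hjl ≫ Z.map (tw_le_left hjl) ◁ θ₄ =
      R.unit hkl' ≫ R.unit hjk' ▷ R.hom hkl ≫ (α_ _ _ _).hom := h₄.unit_comp hjl
  refine R.unit_cancel ?_
  calc
    _ = (R.unit hil ≫ Z.map (tw_le_left hil) ◁ θ₁) ≫
          Z.map (tw_le_left hil) ◁ (θ₂ ▷ R.hom hkl ≫ (α_ _ _ _).hom) := by
      rw [whiskerLeft_comp, Category.assoc]
    _ = R.unit hkl' ≫ (R.unit hik ≫ Z.map (tw_le_left hil) ◁ θ₂) ▷ R.hom hkl ⊗≫ 𝟙 _ := by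
      rw [e₁]; bicategory
    _ = (R.unit hkl' ≫ R.unit hjk' ▷ R.hom hkl ≫ (α_ _ _ _).hom) ≫
          R.unit hij' ▷ (R.hom hjk ≫ R.hom hkl) ⊗≫ 𝟙 _ := by
      rw [e₂]; bicategory
    _ = R.unit hjl ≫ (Z.map (tw_le_left hjl) ◁ θ₄ ≫
          R.unit hij' ▷ (R.hom hjk ≫ R.hom hkl)) ⊗≫ 𝟙 _ := by
      rw [← e₄]; bicategory
    _ = (R.unit hjl ≫ R.unit hij' ▷ R.hom (hjk.trans hkl) ≫ (α_ _ _ _).hom) ≫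
          Z.map (tw_le_left hil) ◁ R.hom hij ◁ θ₄ := by
      rw [whisker_exchange]; bicategory
    _ = _ := by
      rw [← e₃, whiskerLeft_comp, Category.assoc]

/-! ### Normality of the unfurled cells -/

section Units

variable {R : Z.RightAdjoints}

/-- The condition that `R` consists of the identity adjunction at a degenerate pair. -/
def IsNormalAt (R : Z.RightAdjoints) (i : Fin (n + 1)) (e : R.hom (le_refl i) = 𝟙 _) : Prop :=
  (R.adj (le_refl i)).whiskerUnit (Z.map (tw_le (le_refl i) le_rfl le_rfl le_rfl)) ≫
    Z.map (tw_le (le_refl i) le_rfl le_rfl le_rfl) ◁ eqToHom e ≫ (ρ_ _).hom = 𝟙 _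

/-- Over a general `x` the expression is the one in `IsNormalAt`, whiskered with `Z.map hx` and
conjugated by an invertible comparison cell. -/
theorem IsNormalAt.unit_comp {i : Fin (n + 1)} {e : R.hom (le_refl i) = 𝟙 _}
    (hi : R.IsNormalAt i e) {x : TwOp n} (hx : x ≤ tw i i le_rfl) :
    R.unit hx ≫ Z.map hx ◁ eqToHom e ≫ (ρ_ _).hom = 𝟙 _ := by
  set c := Z.comp hx (tw_le (le_refl i) le_rfl le_rfl le_rfl)
  calc
    _ = c ≫ Z.map hx ◁ (R.adj (le_refl i)).whiskerUnit _ ≫ (α_ _ _ _).inv ≫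
          (inv c ▷ R.hom (le_refl i) ≫ Z.map hx ◁ eqToHom e) ≫ (ρ_ _).hom := by
      simp only [unit, Category.assoc]; rfl
    _ = c ≫ Z.map hx ◁ ((R.adj (le_refl i)).whiskerUnit
          (Z.map (tw_le (le_refl i) le_rfl le_rfl le_rfl)) ≫
          Z.map (tw_le (le_refl i) le_rfl le_rfl le_rfl) ◁ eqToHom e ≫ (ρ_ _).hom) ≫ inv c := by
      rw [← whisker_exchange]
      simp only [hom]
      bicategory
    _ = _ := by
      rw [hi]
      simp

/-- After transposition the unit of the degenerate pair is a whiskered factor, which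
`IsNormalAt.unit_comp` removes; in `comp_right` an interchange is needed first. -/
theorem IsCell.comp_left {i j : Fin (n + 1)} {h : i ≤ j}
    {θ : R.hom h ⟶ R.hom (le_refl i) ≫ R.hom h} (hθ : R.IsCell (le_refl i) h θ)
    {e : R.hom (le_refl i) = 𝟙 _} (hi : R.IsNormalAt i e) :
    θ ≫ eqToHom e ▷ R.hom h ≫ (λ_ (R.hom h)).hom = 𝟙 _ := by
  refine R.unit_cancel ?_
  have h₁ : R.unit (le_refl (tw i j h)) ≫ Z.map (tw_le_left (le_refl (tw i j h))) ◁ θ = _ := hθ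
  rw [whiskerLeft_comp, ← Category.assoc, h₁]
  have h₂ := hi.unit_comp (tw_le_left (le_refl (tw i j h)))
  calc
    _ = R.unit (le_refl (tw i j h)) ≫ (R.unit (tw_le_left (le_refl (tw i j h))) ≫
          Z.map (tw_le_left (le_refl (tw i j h))) ◁ eqToHom e ≫ (ρ_ _).hom) ▷ R.hom h := by
      simp only [comp_whiskerRight, Category.assoc, whiskerLeft_comp]
      congr 2
      bicategory
    _ = _ := by
      rw [h₂]
      simp

theorem IsCell.comp_right {i j : Fin (n + 1)} {h : i ≤ j}
    {θ : R.hom h ⟶ R.hom h ≫ R.hom (le_refl j)} (hθ : R.IsCell h (le_refl j) θ)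
    {e : R.hom (le_refl j) = 𝟙 _} (hj : R.IsNormalAt j e) :
    θ ≫ R.hom h ◁ eqToHom e ≫ (ρ_ (R.hom h)).hom = 𝟙 _ := by
  refine R.unit_cancel ?_
  have h₁ : R.unit (le_refl (tw i j h)) ≫ Z.map (tw_le_left (le_refl (tw i j h))) ◁ θ = _ := hθ
  rw [whiskerLeft_comp, ← Category.assoc, h₁]
  have h₂ := hj.unit_comp (tw_le_right (le_refl (tw i j h)))
  calc
    _ = R.unit (tw_le_right (le_refl (tw i j h))) ≫
          (R.unit (le_refl (tw i j h)) ▷ R.hom (le_refl j) ≫ _ ◁ eqToHom e) ≫ (ρ_ _).hom := by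
      simp only [Category.assoc, whiskerLeft_comp]
      congr 2
      bicategory
    _ = (R.unit (tw_le_right (le_refl (tw i j h))) ≫
          Z.map (tw_le_right (le_refl (tw i j h))) ◁ eqToHom e ≫ (ρ_ _).hom) ≫
            R.unit (le_refl (tw i j h)) := by
      rw [← whisker_exchange]
      bicategory
    _ = _ := by
      rw [h₂]
      simp

end Units

end NormalDiagram.RightAdjoints

end TwistedDiagram

/-! ### Images of normal diagrams under strict functors -/

section Image

variable {I C : Type u} [Bicategory.{w, v} I] [Bicategory.{w, v} C] (φ : StrictPseudofunctor I C)

/-- The image of a normal diagram under a strict pseudofunctor. -/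
def NormalDiagram.image {P : Type} [Preorder P] (Y : NormalDiagram P I) : NormalDiagram P C where
  obj i := φ.obj (Y.obj i)
  map h := φ.map (Y.map h)
  map_refl i := (congrArg φ.map (Y.map_refl i)).trans (φ.map_id _)
  comp h h' := φ.map₂ (Y.comp h h') ≫ (φ.mapComp _ _).hom
  comp_refl_left {i j} h := by
    -- The unit constraint that `φ` contributes is an `eqToHom` by strictness, as the normality
    -- axiom requires.
    have e := congrArg φ.map₂ (Y.comp_refl_left h)
    rw [PrelaxFunctor.map₂_comp, PrelaxFunctor.map₂_comp, Pseudofunctor.map₂_whisker_right] at e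
    simp only [Pseudofunctor.map₂_left_unitor, PrelaxFunctor.map₂_eqToHom, PrelaxFunctor.map₂_id,
      φ.mapId_eq_eqToIso, eqToIso.hom] at e
    simpa [φ.mapComp_eq_eqToIso] using e
  comp_refl_right {i j} h := by
    have e := congrArg φ.map₂ (Y.comp_refl_right h)
    rw [PrelaxFunctor.map₂_comp, PrelaxFunctor.map₂_comp, Pseudofunctor.map₂_whisker_left] at e
    simp only [Pseudofunctor.map₂_right_unitor, PrelaxFunctor.map₂_eqToHom, PrelaxFunctor.map₂_id,
      φ.mapId_eq_eqToIso, eqToIso.hom] at e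
    simpa [φ.mapComp_eq_eqToIso] using e
  comp_assoc h h' h'' := by
    have e := congrArg φ.map₂ (Y.comp_assoc h h' h'')
    simp only [PrelaxFunctor.map₂_comp, Pseudofunctor.map₂_whisker_left,
      Pseudofunctor.map₂_whisker_right, Pseudofunctor.map₂_associator] at e
    simp only [comp_whiskerRight, whiskerLeft_comp, Category.assoc]
    rw [← cancel_mono ((φ.map (Y.map h)) ◁ (φ.mapComp (Y.map h') (Y.map h'')).inv ≫
      (φ.mapComp _ _).inv)]
    simpa using e

instance {P : Type} [Preorder P] (Y : NormalDiagram P I) [IsLocallyGroupoid I] {i j k : P}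
    (h : i ≤ j) (h' : j ≤ k) : IsIso ((Y.image φ).comp h h') :=
  inferInstanceAs (IsIso (φ.map₂ (Y.comp h h') ≫ (φ.mapComp _ _).hom))

end Image

/-! ### The unfurled diagram -/

section Unfurl

variable {I C : Type u} [Bicategory.{w, v} I] [Bicategory.{w, v} C]
  {φ : StrictPseudofunctor I C} {D : TwoSubcategory I}

namespace RightAdjointChoice

variable (R : RightAdjointChoice φ D) {n : ℕ} (Y : NormalDiagram (TwOp n) I)
  {In : (duskinNerve I).Subcomplex} (hY : IsCartesianDiagram In D.nerve Y.toNerve)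

/-- The chosen right adjoints of the egressive `1`-cells of a cartesian diagram. -/
def rightAdjoints : (Y.image φ).RightAdjoints where
  right h := R.right (Y.map (tw_le h le_rfl le_rfl h)) (hY.hom_mem le_rfl h)
  adj h := R.adj (Y.map (tw_le h le_rfl le_rfl h)) (hY.hom_mem le_rfl h)

theorem right_of_eq_id {a : I} {i : a ⟶ a} (e : i = 𝟙 a) (hi : D.hom i) :
    R.right i hi = 𝟙 _ := by
  cases e; exact R.right_id a hi

/-- With `p` and `r` replaced by identities, the unit is an inverse unitor and, by strictness of
`C`, so is `eqToHom e` a unitor; coherence does the rest. -/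
theorem whiskerUnit_of_unit_id [Bicategory.Strict C] {x : C} {p r : x ⟶ x} (hp : p = 𝟙 x)
    (hr : r = 𝟙 x) (adj : p ⊣ r)
    (hu : adj.unit ≫ eqToHom hp ▷ r ≫ (λ_ _).hom ≫ eqToHom hr = 𝟙 _) (e : r ≫ p = 𝟙 x) :
    adj.whiskerUnit p ≫ p ◁ eqToHom e ≫ (ρ_ _).hom = 𝟙 p := by
  subst hp hr
  have h₁ : eqToHom e = (λ_ _).hom := by
    rw [Bicategory.Strict.leftUnitor_eqToIso]
    rfl
  have h₂ : adj.unit = (λ_ _).inv := by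
    rw [← cancel_mono (λ_ _).hom]
    simpa using hu
  rw [h₁, Bicategory.Adjunction.whiskerUnit, h₂]
  bicategory

theorem whiskerUnit_of_eq_id [Bicategory.Strict C] {a : I} {i : a ⟶ a} (h : i = 𝟙 a)
    (hi : D.hom i) (e : R.right i hi ≫ φ.map i = 𝟙 (φ.obj a)) :
    (R.adj i hi).whiskerUnit (φ.map i) ≫ φ.map i ◁ eqToHom e ≫ (ρ_ _).hom = 𝟙 _ := by
  subst h
  have hu := R.unit_id a hi
  rw [φ.mapId_eq_eqToIso] at hu
  exact whiskerUnit_of_unit_id (φ.map_id a) (R.right_id a hi) _ hu e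

theorem isNormalAt [Bicategory.Strict C] (i : Fin (n + 1)) :
    ∃ e, (R.rightAdjoints Y hY).IsNormalAt i e := by
  have e₀ : R.right (Y.map (tw_le (le_refl i) le_rfl le_rfl le_rfl)) (hY.hom_mem le_rfl le_rfl) =
    𝟙 _ := R.right_of_eq_id (Y.map_refl _) _
  have e : (R.rightAdjoints Y hY).hom (le_refl i) = 𝟙 _ :=
    (congrArg (· ≫ φ.map (Y.map _)) e₀).trans
      ((Bicategory.Strict.id_comp _).trans ((congrArg φ.map (Y.map_refl _)).trans (φ.map_id _)))
  exact ⟨e, R.whiskerUnit_of_eq_id (Y.map_refl _) _ e⟩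

variable [IsLocallyGroupoid I]

/-- The `2`-cell of the unfurled diagram at `i ≤ j ≤ k`. -/
noncomputable def cellAt {i j k : Fin (n + 1)} (hij : i ≤ j) (hjk : j ≤ k) :
    (R.rightAdjoints Y hY).hom (hij.trans hjk) ⟶
      (R.rightAdjoints Y hY).hom hij ≫ (R.rightAdjoints Y hY).hom hjk :=
  R.pasting (hY.hom_mem le_rfl hij) (hY.hom_mem hij hjk) (hY.hom_mem le_rfl (hij.trans hjk))
    (hY.hom_mem le_rfl hjk)
    (Y.comp (i := tw i k (hij.trans hjk)) (j := tw i j hij) (k := tw i i le_rfl)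
      (tw_le _ _ le_rfl hjk) (tw_le _ _ le_rfl hij))
    (inv (Y.comp (i := tw i k (hij.trans hjk)) (j := tw j k hjk) (k := tw j j le_rfl)
      (tw_le _ _ hij le_rfl) (tw_le _ _ le_rfl hjk)) ≫
      Y.comp (i := tw i k (hij.trans hjk)) (j := tw i j hij) (k := tw j j le_rfl)
      (tw_le _ _ le_rfl hjk) (tw_le _ _ hij le_rfl))
    (Y.comp (i := tw i k (hij.trans hjk)) (j := tw j k hjk) (k := tw k k le_rfl)
      (tw_le _ _ hij le_rfl) (tw_le _ _ hjk le_rfl))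

/-- Connects the explicit pasting with its characterization: the transpose of the pasting splits
into the units of `j ≤ k` and `i ≤ j` over `(i ≤ k)`. -/
theorem isCell_cellAt {i j k : Fin (n + 1)} (hij : i ≤ j) (hjk : j ≤ k) :
    (R.rightAdjoints Y hY).IsCell hij hjk (R.cellAt Y hY hij hjk) := by
  -- Identifies the image of the pasted square with the pasting of the image triangles, so that
  -- `whiskerUnit_pasting` applies to the diagram in `C`.
  have hσ : ∀ {a b c d : I} {k : a ⟶ d} {g : a ⟶ b} {i : b ⟶ d} {j : a ⟶ c} {f : c ⟶ d}
      (γ : k ⟶ g ≫ i) (δ : k ⟶ j ≫ f),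
      (φ.mapComp g i).inv ≫ φ.map₂ (inv γ ≫ δ) ≫ (φ.mapComp j f).hom =
        inv (φ.map₂ γ ≫ (φ.mapComp g i).hom) ≫ φ.map₂ δ ≫ (φ.mapComp j f).hom := by
    intros
    simp
  let R' := R.rightAdjoints Y hY
  -- The leg `(i ≤ k) → (i ≤ j)` does not end at a degenerate pair, so its adjunction comes from `R`
  -- and not from `R'`.
  let r₀₁ : (Y.image φ).obj (tw i j hij) ⟶ (Y.image φ).obj (tw i k (hij.trans hjk)) :=
    R.right (Y.map (tw_le (hij.trans hjk) hij le_rfl hjk)) (hY.hom_mem hij hjk)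
  let adj₀₁ : (Y.image φ).map (tw_le (hij.trans hjk) hij le_rfl hjk) ⊣ r₀₁ :=
    R.adj (Y.map (tw_le (hij.trans hjk) hij le_rfl hjk)) (hY.hom_mem hij hjk)
  rw [NormalDiagram.RightAdjoints.IsCell, NormalDiagram.RightAdjoints.unit_refl]
  have key := whiskerUnit_pasting (R'.adj hij)
    adj₀₁ (R'.adj (hij.trans hjk)) (R'.adj hjk)
    ((Y.image φ).comp (tw_le (hij.trans hjk) hij le_rfl hjk) (tw_le hij le_rfl le_rfl hij))
    (inv ((Y.image φ).comp (tw_le (hij.trans hjk) hjk hij le_rfl) (tw_le hjk le_rfl le_rfl hjk)) ≫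
      (Y.image φ).comp (tw_le (hij.trans hjk) hij le_rfl hjk) (tw_le hij le_rfl hij le_rfl))
    ((Y.image φ).comp (tw_le (hij.trans hjk) hjk hij le_rfl) (tw_le hjk le_rfl hjk le_rfl))
  refine Eq.trans ?_ (key.trans ?_)
  · simp only [cellAt, pasting, canonicalMate, totalMate, hσ]
    rfl
  · simp only [NormalDiagram.RightAdjoints.unit]
    bicategory

theorem isIso_pasting {A B E F G H : I}
    {j₁₂ : B ⟶ A} {j₀₁ : G ⟶ B} {j₀₂ : G ⟶ A} {f : B ⟶ F} {i : H ⟶ F}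
    {g₀₁ : G ⟶ H} {g₁₂ : H ⟶ E} {g₀₂ : G ⟶ E}
    (h₁₂ : D.hom j₁₂) (h₀₁ : D.hom j₀₁) (h₀₂ : D.hom j₀₂) (hi : D.hom i)
    (ρ : j₀₂ ⟶ j₀₁ ≫ j₁₂) (σ : g₀₁ ≫ i ⟶ j₀₁ ≫ f) (τ : g₀₂ ⟶ g₀₁ ≫ g₁₂)
    (hσ : IsIso (canonicalMate φ (R.adj j₀₁ h₀₁) (R.adj i hi) σ)) :
    IsIso (R.pasting h₁₂ h₀₁ h₀₂ hi ρ σ τ) := by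
  unfold pasting bicategoricalComp
  infer_instance

/-- The relevant pullback has corners `(i ≤ k)`, `(j ≤ k)`, `(i ≤ j)`, `(j ≤ j)`: the square of `i ≤
j ≤ j ≤ k`. -/
theorem isIso_cellAt (hBC : BeckChevalley φ D) {i j k : Fin (n + 1)} (hij : i ≤ j)
    (hjk : j ≤ k) : IsIso (R.cellAt Y hY hij hjk) :=
  R.isIso_pasting _ _ _ _ _ _ _
    (hBC (Y.restrict (TwOp.square hij (le_refl j) hjk)) (hY hij (le_refl j) hjk).isPullback
      (hY.hom_mem hij hjk) (hY.hom_mem le_rfl hjk) _ _)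

theorem _root_.CategoryTheory.Bicategory.Pith.eqToHom_iso_hom {a b : Pith C} {f g : a ⟶ b}
    (e : f = g) : (eqToHom e).iso.hom = eqToHom (congrArg Core.of e) := by
  cases e; rfl

/-- The normal diagram in `Pith C` obtained from a cartesian diagram in `I`. -/
noncomputable def unfurl [Bicategory.Strict C] (hBC : BeckChevalley φ D) :
    NormalDiagram (Fin (n + 1)) (Pith C) where
  obj i := ⟨φ.obj (Y.obj (tw i i le_rfl))⟩
  map h := ⟨(R.rightAdjoints Y hY).hom h⟩
  map_refl i := congrArg Core.mk (R.isNormalAt Y hY i).choose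
  comp h h' :=
    CoreHom.mk (@asIso _ _ _ _ (R.cellAt Y hY h h') (R.isIso_cellAt Y hY hBC h h'))
  comp_refl_left {i j} h := by
    apply Pith.hom₂_ext
    have e := (R.isCell_cellAt Y hY (le_refl i) h).comp_left (R.isNormalAt Y hY i).choose_spec
    simp only [Pith.comp₂_iso_hom, Pith.whiskerRight_iso_hom, Pith.eqToHom_iso_hom]
    exact e
  comp_refl_right {i j} h := by
    apply Pith.hom₂_ext
    have e := (R.isCell_cellAt Y hY h (le_refl j)).comp_right (R.isNormalAt Y hY j).choose_spec
    simp only [Pith.comp₂_iso_hom, Pith.whiskerLeft_iso_hom, Pith.eqToHom_iso_hom]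
    exact e
  comp_assoc h h' h'' := by
    apply Pith.hom₂_ext
    exact (R.isCell_cellAt Y hY _ _).coherence (R.isCell_cellAt Y hY _ _)
      (R.isCell_cellAt Y hY _ _) (R.isCell_cellAt Y hY _ _)

theorem unfurl_congr [Bicategory.Strict C] (hBC : BeckChevalley φ D)
    {Y Y' : NormalDiagram (TwOp n) I} (e : Y = Y')
    (hY : IsCartesianDiagram In D.nerve Y.toNerve)
    (hY' : IsCartesianDiagram In D.nerve Y'.toNerve) :
    R.unfurl Y hY hBC = R.unfurl Y' hY' hBC := by
  cases e; rfl

end RightAdjointChoice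

end Unfurl

/-! ### The existence of normalized right adjoints -/

section Existence

variable {I C : Type u} [Bicategory.{w, v} I] [Bicategory.{w, v} C]
  {φ : StrictPseudofunctor I C} {D : TwoSubcategory I}

/-- The identity adjunction, for a `1`-cell that is equal to the identity. -/
def adjunctionOfEqId {x : C} {p : x ⟶ x} (hp : p = 𝟙 x) : p ⊣ 𝟙 x :=
  hp ▸ Bicategory.Adjunction.id x

theorem adjunctionOfEqId_unit {x : C} {p : x ⟶ x} (hp : p = 𝟙 x) :
    (adjunctionOfEqId hp).unit ≫ eqToHom hp ▷ 𝟙 x ≫ (λ_ _).hom = 𝟙 _ := by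
  subst hp
  simp [adjunctionOfEqId, Bicategory.Adjunction.id, unitors_equal]

theorem RightAdjointChoice.nonempty
    (hadj : ∀ {a b : I} (i : a ⟶ b), D.hom i → IsLeftAdjoint (φ.map i)) :
    Nonempty (RightAdjointChoice φ D) := by
  let idPair (a : I) : Σ r, φ.map (𝟙 a) ⊣ r := ⟨𝟙 _, adjunctionOfEqId (φ.map_id a)⟩
  -- The choice runs over the total type of `1`-cells of `D`, so that being an identity is an
  -- equation in one type; `HEq` then prescribes the value there.
  have h : ∀ x : Σ a b : I, {i : a ⟶ b // D.hom i}, ∃ p : Σ r, φ.map x.2.2.1 ⊣ r,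
      ∀ (a : I) (ha : D.hom (𝟙 a)), x = ⟨a, a, 𝟙 a, ha⟩ → HEq p (idPair a) := by
    intro x
    by_cases hx : ∃ (a : I) (ha : D.hom (𝟙 a)), x = ⟨a, a, 𝟙 a, ha⟩
    · obtain ⟨a, ha, rfl⟩ := hx
      refine ⟨idPair a, fun a' ha' e => ?_⟩
      obtain rfl : a = a' := congrArg Sigma.fst e
      rfl
    · obtain ⟨⟨r, adj⟩⟩ := (hadj x.2.2.1 x.2.2.2).nonempty
      exact ⟨⟨r, adj⟩, fun a ha e => absurd ⟨a, ha, e⟩ hx⟩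
  choose p hp using h
  have hp' : ∀ (a : I) (ha : D.hom (𝟙 a)), p ⟨a, a, 𝟙 a, ha⟩ = idPair a :=
    fun a ha => eq_of_heq (hp _ a ha rfl)
  refine ⟨⟨fun i hi => (p ⟨_, _, i, hi⟩).1, fun i hi => (p ⟨_, _, i, hi⟩).2,
    fun a ha => congrArg Sigma.fst (hp' a ha), fun a ha => ?_⟩⟩
  have key : ∀ (q : Σ r, φ.map (𝟙 a) ⊣ r) (hq : q = idPair a),
      q.2.unit ≫ (φ.mapId a).hom ▷ q.1 ≫ (λ_ _).hom ≫ eqToHom (congrArg Sigma.fst hq) =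
        𝟙 (𝟙 (φ.obj a)) := by
    rintro q rfl
    rw [φ.mapId_eq_eqToIso]
    rw [eqToHom_refl, Category.comp_id]
    exact adjunctionOfEqId_unit (φ.map_id a)
  exact key _ (hp' a ha)

end Existence

/-! ### The functor on the effective Burnside category -/

section Functor

variable {I C : Type u} [Bicategory.{w, v} I] [Bicategory.{w, v} C]
  {φ : StrictPseudofunctor I C} {D : TwoSubcategory I} {In : (duskinNerve I).Subcomplex}

theorem isCartesianDiagram_ofNerve {n : ℕ} {s : ordNerve (TwOp n) ⟶ duskinNerve I}
    (hs : IsCartesianDiagram In D.nerve s) :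
    IsCartesianDiagram In D.nerve (NormalDiagram.ofNerve s).toNerve := by
  rwa [NormalDiagram.toNerve_ofNerve]

/-- Two maps from the effective Burnside category into a Duskin nerve agree if they agree on the
`2`-simplices that are given by normal diagrams. -/
theorem effBurnside_hom_ext {E : Type u} [Bicategory.{w, v} E]
    {Φ Ψ : effBurnside (duskinNerve I) In D.nerve ⟶ duskinNerve E}
    (h : ∀ (Y : NormalDiagram (TwOp 2) I) (hY : IsCartesianDiagram In D.nerve Y.toNerve),
      Φ.app (op (SimplexCategory.mk 2)) ⟨Y.toNerve, hY⟩ =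
        Ψ.app (op (SimplexCategory.mk 2)) ⟨Y.toNerve, hY⟩) : Φ = Ψ := by
  ext m s
  induction m using Opposite.rec with | op m
  induction m using SimplexCategory.rec with | mk m
  -- Restricting to `[2]` and using naturality reduces to `2`-simplices, each of which comes from a
  -- normal diagram via `ofNerve`.
  refine NormalDiagram.ext_of_restrict fun f => ?_
  let g : SimplexCategory.mk 2 ⟶ SimplexCategory.mk m := SimplexCategory.mkHom f
  have h₁ := NatTrans.naturality_apply Φ g.op s
  have h₂ := NatTrans.naturality_apply Ψ g.op s
  have h₃ : ∀ t : (effBurnside (duskinNerve I) In D.nerve).obj (op (SimplexCategory.mk 2)),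
      Φ.app _ t = Ψ.app _ t := by
    rintro ⟨t, ht⟩
    have e := h (NormalDiagram.ofNerve t) (isCartesianDiagram_ofNerve ht)
    simpa only [NormalDiagram.toNerve_ofNerve] using e
  exact h₁.symm.trans ((h₃ _).trans h₂)

variable [IsLocallyGroupoid I] [Bicategory.Strict C]

/-- The functor obtained from the unfurling construction. -/
noncomputable def RightAdjointChoice.unfurlFunctor (R : RightAdjointChoice φ D)
    (hBC : BeckChevalley φ D) :
    effBurnside (duskinNerve I) In D.nerve ⟶ duskinNerve (Pith C) where
  app m := TypeCat.ofHom fun s =>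
    R.unfurl (NormalDiagram.ofNerve s.1) (isCartesianDiagram_ofNerve s.2) hBC
  naturality m n f := by
    ext s
    -- Unfurling commutes with restriction by definition; it remains to see that `ofNerve` does.
    refine R.unfurl_congr hBC
      (Y' := (NormalDiagram.ofNerve s.1).restrict (TwOp.map f.unop.toOrderHom)) ?_ _
      ((isCartesianDiagram_ofNerve s.2).comp_map f.unop.toOrderHom)
    apply NormalDiagram.toNerve_injective
    rw [NormalDiagram.toNerve_ofNerve, NormalDiagram.toNerve_restrict,
      NormalDiagram.toNerve_ofNerve]
    rfl

end Functor

theorem mainTheorem5 {I C : Type u} [Bicategory.{w, v} I] [Bicategory.Strict I]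
    [IsLocallyGroupoid I] [Bicategory.{w, v} C] [Bicategory.Strict C]
    (D : TwoSubcategory I)
    (hD : IsAdequateTriple (duskinNerve I) (⊤ : (duskinNerve I).Subcomplex) D.nerve)
    (φ : StrictPseudofunctor I C)
    (hadj : ∀ {a b : I} (i : a ⟶ b), D.hom i → IsLeftAdjoint (φ.map i))
    (hBC : BeckChevalley φ D) :
    Nonempty (RightAdjointChoice φ D) ∧
    ∀ R : RightAdjointChoice φ D,
      ∃! Φ : effBurnside (duskinNerve I) (⊤ : (duskinNerve I).Subcomplex) D.nerve ⟶
          duskinNerve (Pith C),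
        ∀ (Y : NormalDiagram (TwOp 2) I)
          (hY : IsCartesianDiagram (⊤ : (duskinNerve I).Subcomplex) D.nerve Y.toNerve),
          ∃ _ : IsIso (R.cell Y hY),
            Φ.app (op (SimplexCategory.mk 2)) ⟨Y.toNerve, hY⟩ = pithTriangle (R.cell Y hY) := by

  refine ⟨RightAdjointChoice.nonempty hadj, fun R => ⟨R.unfurlFunctor hBC, fun Y hY => ?_,
    fun Ψ hΨ => ?_⟩⟩
  · have e : (R.unfurlFunctor hBC).app (op (SimplexCategory.mk 2)) ⟨Y.toNerve, hY⟩ =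
        R.unfurl Y hY hBC :=
      R.unfurl_congr hBC (NormalDiagram.ofNerve_toNerve Y) _ _
    -- `R.cell` is `cellAt` for `0 ≤ 1 ≤ 2`, and a `2`-simplex is the triangle on its `2`-cell.
    exact ⟨R.isIso_cellAt Y hY hBC _ _, e.trans (NormalDiagram.eq_triangle _)⟩
  · refine effBurnside_hom_ext fun Y hY => ?_
    obtain ⟨_, e⟩ := hΨ Y hY
    have e' : (R.unfurlFunctor hBC).app (op (SimplexCategory.mk 2)) ⟨Y.toNerve, hY⟩ =
        R.unfurl Y hY hBC :=
      R.unfurl_congr hBC (NormalDiagram.ofNerve_toNerve Y) _ _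
    exact e.trans (e'.trans (NormalDiagram.eq_triangle _)).symm
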